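/- **Setting.** Let $N\ge 1$ and let $\Omega\subset\mathbb R^N$ be a bounded connected domain with $C^{1,\alpha}$ boundary for some $\alpha\in(0,1)$. Let $J:\mathbb R^N\to\mathbb R$ be radially symmetric, nonnegative, continuous and compactly supported, with $J(0)>0$, $\int_{\mathbb R^N}J=1$, and $J(x)>0$ for $|x|<R_J$, where $R_J=\inf\{R: J=0 \text{ in } \mathbb R^N\setminus B(0,R)\}$. Functions in $W^{1,p}_0(\Omega)$ are extended by $0$ outside $\Omega$. For $p\ge 2$ and $u,v\in W^{1,p}_0(\Omega)$ put $$\mathcal H_{J,p}(u,v)=\int_\Omega|\nabla u|^{p-2}\nabla u\cdot\nabla v\,dx+\int_{\mathbb R^N}\int_{\mathbb R^N}J(x-y)|u(x)-u(y)|^{p-2}(u(x)-u(y))(v(x)-v(y))\,dx\,dy,$$ $$\lambda_1(p)=\inf\left\{\frac{\mathcal H_{J,p}(u,u)}{\|u\|_{L^p(\Omega)}^p}: u\in W^{1,p}_0(\Omega)\setminus\{0\}\right\}.$$ An eigenfunction corresponding to $\lambda_1(p)$ is a nontrivial $u\in W^{1,p}_0(\Omega)$ with $\mathcal H_{J,p}(u,v)=\lambda_1(p)\int_\Omega|u|^{p-2}uv\,dx$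 for all $v\in W^{1,p}_0(\Omega)$. Let $W^{1,\infty}_0(\Omega)$ be the space of $u\in W^{1,\infty}(\Omega)$ whose continuous representative vanishes on $\partial\Omega$ (extended by $0$ outside $\Omega$), and for such $u$ put $[u]_J=\sup\{|u(x)-u(y)|: x-y\in\operatorname{supp}J\}$ and $$\Lambda=\inf\left\{\frac{\max\{\|\nabla u\|_{L^\infty(\Omega)},[u]_J\}}{\|u\|_{L^\infty(\Omega)}}: u\in W^{1,\infty}_0(\Omega)\setminus\{0\}\right\}.$$ **Theorem 1.2.** It holds that $\lim_{p\to\infty}[\lambda_1(p)]^{1/p}=\Lambda$. Moreover, for each $p\ge 2$ let $u_p$ be a nonnegative eigenfunction corresponding to $\lambda_1(p)$, normalized by $\|u_p\|_{L^p(\Omega)}=1$. Then there are a sequence $p_n\to\infty$ and a nonzero $u_\infty\in W^{1,\infty}_0(\Omega)$ such that $u_{p_n}$ has a continuous representative vanishing on $\partial\Omega$ for each $n$, these representatives converge to $u_\infty$ uniformly in $\overline\Omega$, and $$\Lambda=\frac{\max\{\|\nabla u_\infty\|_{L^\infty(\Omega)},[u_\infty]_J\}}{\|u_\infty\|_{L^\infty(\Omega)}}.$$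 -/

import Mathlib

open MeasureTheory Filter Topology
open scoped ENNReal NNReal ContDiff Gradient

namespace LocalNonlocal

/-- The Euclidean space `ℝ^N`. -/
abbrev Sp (N : ℕ) : Type := EuclideanSpace ℝ (Fin N)

noncomputable section

/-! ### Domains and kernels -/

/-- `Ω` has `C^{1,α}` boundary: near each boundary point, `Ω` is the set of points lying strictly
above the graph of a function `γ` with `α`-Hölder continuous gradient. Here the unit vector `e`
is the vertical direction, `⟪e, x⟫` is the height of `x`, and `x - ⟪e, x⟫ e` is its projection to
the horizontal hyperplane `e^⊥`; only the values of `γ` on `e^⊥` matter. -/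
def HasC1HolderBoundary {N : ℕ} (α : ℝ≥0) (Ω : Set (Sp N)) : Prop :=
  ∀ z ∈ frontier Ω, ∃ (r : ℝ) (e : Sp N) (γ : Sp N → ℝ) (C : ℝ≥0),
    0 < r ∧ ‖e‖ = 1 ∧ ContDiff ℝ 1 γ ∧ HolderWith C α (fderiv ℝ γ) ∧
    ∀ x ∈ Metric.ball z r, x ∈ Ω ↔ γ (x - inner ℝ e x • e) < inner ℝ e x

/-- Bounded connected domains with `C^{1,α}` boundary for some `α ∈ (0, 1)`. -/
structure IsC1HolderDomain {N : ℕ} (Ω : Set (Sp N)) : Prop where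
  isOpen : IsOpen Ω
  isConnected : IsConnected Ω
  isBounded : Bornology.IsBounded Ω
  boundary : ∃ α : ℝ≥0, 0 < α ∧ α < 1 ∧ HasC1HolderBoundary α Ω

/-- `R_J`: the infimum of the `R` such that `J = 0` outside the open ball `B(0, R)`. -/
def kernelRadius {N : ℕ} (J : Sp N → ℝ) : ℝ :=
  sInf {R : ℝ | ∀ x, x ∉ Metric.ball (0 : Sp N) R → J x = 0}

/-- The kernels under consideration. -/
structure IsKernel {N : ℕ} (J : Sp N → ℝ) : Prop where
  radial : ∀ x y, ‖x‖ = ‖y‖ → J x = J y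
  nonneg : ∀ x, 0 ≤ J x
  continuous : Continuous J
  hasCompactSupport : HasCompactSupport J
  pos_zero : 0 < J 0
  integral_eq_one : ∫ x, J x = 1
  pos : ∀ x, ‖x‖ < kernelRadius J → 0 < J x

/-! ### Sobolev spaces -/

/-- `φ ∈ C_c^∞(Ω)`. -/
structure IsTestFun {N : ℕ} (Ω : Set (Sp N)) (φ : Sp N → ℝ) : Prop where
  contDiff : ContDiff ℝ ∞ φ
  hasCompactSupport : HasCompactSupport φ
  tsupport_subset : tsupport φ ⊆ Ω

/-- `G` is a weak (distributional) gradient of `u` in `Ω`. -/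
structure IsWeakGradient {N : ℕ} (Ω : Set (Sp N)) (u : Sp N → ℝ) (G : Sp N → Sp N) : Prop where
  locallyIntegrableOn : LocallyIntegrableOn u Ω
  locallyIntegrableOn_grad : LocallyIntegrableOn G Ω
  integral_eq : ∀ φ, IsTestFun Ω φ → ∀ v : Sp N,
    ∫ x in Ω, u x * fderiv ℝ φ x v = -∫ x in Ω, inner ℝ (G x) v * φ x

open Classical in
/-- The weak gradient of `u` in `Ω` (unique up to null sets of `Ω` if it exists; `0` if `u` has
none). -/
def weakGrad {N : ℕ} (Ω : Set (Sp N)) (u : Sp N → ℝ) : Sp N → Sp N :=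
  if h : ∃ G, IsWeakGradient Ω u G then h.choose else 0

/-- `u ∈ W^{1,p}(Ω)`, `1 ≤ p ≤ ∞`. -/
structure MemW1 {N : ℕ} (p : ℝ≥0∞) (Ω : Set (Sp N)) (u : Sp N → ℝ) : Prop where
  memLp : MemLp u p (volume.restrict Ω)
  exists_grad : ∃ G, IsWeakGradient Ω u G
  memLp_grad : MemLp (weakGrad Ω u) p (volume.restrict Ω)

/-- `u ∈ W^{1,p}_0(Ω)`, `1 ≤ p < ∞`: the closure of `C_c^∞(Ω)` in `W^{1,p}(Ω)`, the functions being
extended by `0` outside `Ω`. -/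
structure MemW10 {N : ℕ} (p : ℝ) (Ω : Set (Sp N)) (u : Sp N → ℝ) : Prop
    extends MemW1 (ENNReal.ofReal p) Ω u where
  eq_zero : ∀ x, x ∉ Ω → u x = 0
  approx : ∃ φ : ℕ → Sp N → ℝ, (∀ n, IsTestFun Ω (φ n)) ∧
    Tendsto (fun n => eLpNorm (fun x => φ n x - u x) (ENNReal.ofReal p) (volume.restrict Ω))
      atTop (𝓝 0) ∧
    Tendsto (fun n => eLpNorm (fun x => ∇ (φ n) x - weakGrad Ω u x) (ENNReal.ofReal p)
      (volume.restrict Ω)) atTop (𝓝 0)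

/-- `u ∈ W^{1,∞}_0(Ω)`: `u ∈ W^{1,∞}(Ω)` has zero boundary values. The function `u` is the
continuous representative, extended by `0` outside `Ω`. (Not the `W^{1,∞}`-closure of `C_c^∞(Ω)`,
which contains `C^1` functions only.) -/
structure MemW1Inf0 {N : ℕ} (Ω : Set (Sp N)) (u : Sp N → ℝ) : Prop extends MemW1 ∞ Ω u where
  continuous : Continuous u
  eq_zero : ∀ x, x ∉ Ω → u x = 0

/-! ### The first eigenvalue and its eigenfunctions -/

/-- The form `ℋ_{J,p}(u, v)`. -/
def energy {N : ℕ} (J : Sp N → ℝ) (Ω : Set (Sp N)) (p : ℝ) (u v : Sp N → ℝ) : ℝ :=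
  (∫ x in Ω, ‖weakGrad Ω u x‖ ^ (p - 2) * inner ℝ (weakGrad Ω u x) (weakGrad Ω v x)) +
  ∫ x, ∫ y, J (x - y) * |u x - u y| ^ (p - 2) * (u x - u y) * (v x - v y)

/-- `λ₁(p)`: the infimum of `ℋ_{J,p}(u, u) / ‖u‖_p^p` over `u ∈ W^{1,p}_0(Ω)`, `u ≠ 0`. -/
def lambdaOne {N : ℕ} (J : Sp N → ℝ) (Ω : Set (Sp N)) (p : ℝ) : ℝ :=
  sInf {t : ℝ | ∃ u, MemW10 p Ω u ∧ ¬ u =ᵐ[volume] 0 ∧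
    t = energy J Ω p u u / ∫ x in Ω, |u x| ^ p}

/-- `u` is an eigenfunction with eigenvalue `lam`: a nontrivial weak solution of the problem
`-Δ_p u - Δ_{J,p} u = lam |u|^{p-2} u` in `Ω`, `u = 0` outside `Ω`. -/
structure IsEigenfunction {N : ℕ} (J : Sp N → ℝ) (Ω : Set (Sp N)) (p lam : ℝ)
    (u : Sp N → ℝ) : Prop where
  mem : MemW10 p Ω u
  nontrivial : ¬ u =ᵐ[volume] 0
  weak_eq : ∀ v, MemW10 p Ω v →
    energy J Ω p u v = lam * ∫ x in Ω, |u x| ^ (p - 2) * u x * v x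

/-! ### The limit problem -/

/-- `[u]_J = sup {|u(x) - u(y)| : x - y ∈ supp J}`. -/
def seminormJ {N : ℕ} (J : Sp N → ℝ) (u : Sp N → ℝ) : ℝ :=
  sSup {t : ℝ | ∃ x y, x - y ∈ tsupport J ∧ t = |u x - u y|}

/-- The quotient `max {‖∇u‖_∞, [u]_J} / ‖u‖_∞`. -/
def quotientInf {N : ℕ} (J : Sp N → ℝ) (Ω : Set (Sp N)) (u : Sp N → ℝ) : ℝ :=
  max (lpNorm (weakGrad Ω u) ∞ (volume.restrict Ω)) (seminormJ J u) /
    lpNorm u ∞ (volume.restrict Ω)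

/-- `Λ`: the infimum of the quotient over the nonzero `u ∈ W^{1,∞}_0(Ω)`. -/
def LambdaInf {N : ℕ} (J : Sp N → ℝ) (Ω : Set (Sp N)) : ℝ :=
  sInf {t : ℝ | ∃ u, MemW1Inf0 Ω u ∧ u ≠ 0 ∧ t = quotientInf J Ω u}

end

end LocalNonlocal

open LocalNonlocal

namespace LocalNonlocal

/-! ### Morrey's inequality with explicit constants -/

section Morrey

variable {N : ℕ} {φ : Sp N → ℝ}

/-! The quantity `lambdaOne J Ω p ^ (1 / p)` is a quotient of `L^p`-type norms, and as `p → ∞` these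
become sup norms: a factor independent of `p` in front of a `p`-th power disappears under the `p`-th
root.

Upper bound. A competitor `u` for `LambdaInf` is soft-thresholded and mollified
(`exists_isTestFun_approx`). Neither operation increases the Lipschitz constant or the oscillation
over differences in the support of `J`, and the loss in sup norm is as small as desired. If `X`
bounds both quantities for the resulting test function and `T` is a level it exceeds, its energy is
at most a constant times `X ^ p` and `∫ |φ| ^ p` is at least a constant times `T ^ p`; roots leave
`X / T`.

Lower bound and convergence. Both come from one compactness statement, `exists_limit_of_energy_le`:
functions with unit `L^q` norm and energy at most `M ^ q`, where `q → ∞` and `M → ℓ`, have a uniform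
limit with quotient at most `ℓ`. Morrey's inequality with explicit constants (`abs_sub_le_gradNorm`)
gives equicontinuity, and in the limit the sharp Lipschitz constant `ℓ`. The nonlocal energy
controls the limit seminorm (`seminormJ_le_of_tendstoUniformly`), and the normalization survives as
a sup norm at least `1` (`one_le_lpNorm_top`). Near-minimizers with `ℓ < LambdaInf J Ω` are thereby
impossible. For eigenfunctions, `ℓ = LambdaInf J Ω`, so the limit is a minimizer.

Sup norms of gradients are exchanged with Lipschitz constants of zero extensions by
`MemW1Inf0.lipschitzWith` and `lpNorm_weakGrad_top_le`. -/

theorem exists_bound_fderiv (h1 : ContDiff ℝ 1 φ) (hc : HasCompactSupport φ) :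
    ∃ C : ℝ, 0 ≤ C ∧ ∀ x, ‖fderiv ℝ φ x‖ ≤ C := by
  obtain ⟨C, hC⟩ := (h1.continuous_fderiv one_ne_zero).bounded_above_of_compact_support
    (hc.fderiv (𝕜 := ℝ))
  exact ⟨C, (norm_nonneg _).trans (hC 0), hC⟩

/-- Differentiation under the integral sign along affine paths. -/
theorem hasDerivAt_integral_affine (h1 : ContDiff ℝ 1 φ) (hc : HasCompactSupport φ)
    {P Q : Sp N → Sp N} (hP : Continuous P) (hQ : Continuous Q) (t : ℝ) :
    HasDerivAt (fun s : ℝ => ∫ z in Metric.closedBall (0 : Sp N) 1, φ (P z + s • Q z))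
      (∫ z in Metric.closedBall (0 : Sp N) 1, fderiv ℝ φ (P z + t • Q z) (Q z)) t := by
  obtain ⟨C, hC0, hC⟩ := exists_bound_fderiv h1 hc
  have hK : IsCompact (Metric.closedBall (0 : Sp N) 1) := isCompact_closedBall 0 1
  have hφ' : Continuous (fderiv ℝ φ) := h1.continuous_fderiv one_ne_zero
  have hφ : Continuous φ := h1.continuous
  refine (hasDerivAt_integral_of_dominated_loc_of_deriv_le
    (F := fun (s : ℝ) z => φ (P z + s • Q z)) (F' := fun s z => fderiv ℝ φ (P z + s • Q z) (Q z))
    (bound := fun z => C * ‖Q z‖) (s := Set.univ) univ_mem ?_ ?_ ?_ ?_ ?_ ?_).2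
  · exact Eventually.of_forall fun s =>
      Continuous.aestronglyMeasurable (by fun_prop)
  · exact (Continuous.continuousOn (by fun_prop)).integrableOn_compact hK
  · exact Continuous.aestronglyMeasurable (by fun_prop)
  · exact Eventually.of_forall fun z s _ => (ContinuousLinearMap.le_opNorm _ _).trans
      (mul_le_mul_of_nonneg_right (hC _) (norm_nonneg _))
  · exact (Continuous.continuousOn (by fun_prop)).integrableOn_compact hK
  · refine Eventually.of_forall fun z s _ => ?_
    have h2 : HasDerivAt (fun s : ℝ => P z + s • Q z) (Q z) s := by
      simpa using ((hasDerivAt_id s).smul_const (Q z)).const_add (P z)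
    exact ((h1.differentiable one_ne_zero _).hasFDerivAt).comp_hasDerivAt s h2

/-- `∫ |∇φ|^p`, raised to the power `1/p`. -/
noncomputable def gradNorm (p : ℝ) (φ : Sp N → ℝ) : ℝ := (∫ x, ‖fderiv ℝ φ x‖ ^ p) ^ (1 / p)

/-- The volume of the unit ball. -/
noncomputable def unitVol (N : ℕ) : ℝ := volume.real (Metric.closedBall (0 : Sp N) 1)

theorem unitVol_pos : 0 < unitVol N :=
  ENNReal.toReal_pos (Metric.measure_closedBall_pos _ _ one_pos).ne'
    (isCompact_closedBall _ _).measure_lt_top.ne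

theorem gradNorm_nonneg (p : ℝ) : 0 ≤ gradNorm p φ :=
  Real.rpow_nonneg (integral_nonneg fun _ => Real.rpow_nonneg (norm_nonneg _) _) _

/-- Hölder's inequality against the constant `1` on the unit ball produces the volume factor; the
substitution `z ↦ a + c • z` contributes `c ^ (-N)`, of which the `p`-th root is taken. -/
theorem integral_fderiv_ball_le (h1 : ContDiff ℝ 1 φ) (hc : HasCompactSupport φ) {p : ℝ}
    (hp : 1 < p) (a : Sp N) {c : ℝ} (hc0 : 0 < c) :
    ∫ z in Metric.closedBall (0 : Sp N) 1, ‖fderiv ℝ φ (a + c • z)‖ ≤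
      unitVol N ^ (1 - 1 / p) * c ^ (-(N / p) : ℝ) * gradNorm p φ := by
  have hφ' : Continuous (fderiv ℝ φ) := h1.continuous_fderiv one_ne_zero
  have hp0 : 0 < p := by linarith
  have hpq : p.HolderConjugate (Real.conjExponent p) := Real.HolderConjugate.conjExponent hp
  have hK : IsCompact (Metric.closedBall (0 : Sp N) 1) := isCompact_closedBall 0 1
  have hcp : HasCompactSupport fun x => ‖fderiv ℝ φ x‖ ^ p := by
    refine (hc.fderiv (𝕜 := ℝ)).comp_left (g := fun L : Sp N →L[ℝ] ℝ => ‖L‖ ^ p) ?_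
    simp [hp0.ne']
  have hcont : Continuous fun x => ‖fderiv ℝ φ x‖ ^ p :=
    hφ'.norm.rpow_const fun _ => Or.inr hp0.le
  have hint : Integrable fun x => ‖fderiv ℝ φ x‖ ^ p := hcont.integrable_of_hasCompactSupport hcp
  have : IsFiniteMeasure (volume.restrict (Metric.closedBall (0 : Sp N) 1)) :=
    ⟨by simpa using hK.measure_lt_top⟩
  obtain ⟨C, hC0, hC⟩ := exists_bound_fderiv h1 hc
  have H := integral_mul_le_Lp_mul_Lq_of_nonneg hpq
    (μ := volume.restrict (Metric.closedBall (0 : Sp N) 1))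
    (f := fun z => ‖fderiv ℝ φ (a + c • z)‖) (g := fun _ => (1 : ℝ))
    (Eventually.of_forall fun _ => norm_nonneg _) (Eventually.of_forall fun _ => zero_le_one)
    (MemLp.of_bound (Continuous.aestronglyMeasurable (by fun_prop)) C
      (Eventually.of_forall fun z => by simpa using hC _)) (memLp_const _)
  simp only [mul_one, Real.one_rpow, integral_const, smul_eq_mul, measureReal_restrict_apply_univ]
    at H
  have e1 : 1 / Real.conjExponent p = 1 - 1 / p := by
    have := hpq.inv_add_inv_eq_one
    simp only [one_div]; linarith
  have H2 : ∫ z in Metric.closedBall (0 : Sp N) 1, ‖fderiv ℝ φ (a + c • z)‖ ^ p ≤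
      c ^ (-N : ℝ) * ∫ x, ‖fderiv ℝ φ x‖ ^ p := by
    have e2 : ∫ z, ‖fderiv ℝ φ (a + c • z)‖ ^ p = c ^ (-N : ℝ) * ∫ x, ‖fderiv ℝ φ x‖ ^ p := by
      have := Measure.integral_comp_smul_of_nonneg (volume : Measure (Sp N))
        (fun x => ‖fderiv ℝ φ (a + x)‖ ^ p) c (hR := hc0.le)
      rw [this, integral_add_left_eq_self (fun x => ‖fderiv ℝ φ x‖ ^ p) a]
      simp [Real.rpow_neg hc0.le]
    rw [← e2]
    refine setIntegral_le_integral ?_ (Eventually.of_forall fun _ =>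
      Real.rpow_nonneg (norm_nonneg _) _)
    have := (hint.comp_add_left a).comp_smul hc0.ne'
    exact this
  refine H.trans ?_
  rw [e1, ← unitVol]
  calc _ ≤ (c ^ (-N : ℝ) * ∫ x, ‖fderiv ℝ φ x‖ ^ p) ^ (1 / p) * unitVol N ^ (1 - 1 / p) := by
        gcongr
        · exact Real.rpow_nonneg unitVol_pos.le _
    _ = _ := by
        rw [Real.mul_rpow (by positivity)
          (integral_nonneg fun _ => Real.rpow_nonneg (norm_nonneg _) _),
          ← Real.rpow_mul hc0.le, gradNorm]
        ring_nf

/-- Comparison of ball averages with different centers. -/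
theorem abs_integral_ball_sub_le (h1 : ContDiff ℝ 1 φ) (hc : HasCompactSupport φ) {p : ℝ}
    (hp : 1 < p) (x y : Sp N) {c : ℝ} (hc0 : 0 < c) :
    |(∫ z in Metric.closedBall (0 : Sp N) 1, φ (x + c • z)) -
        ∫ z in Metric.closedBall (0 : Sp N) 1, φ (y + c • z)| ≤
      ‖x - y‖ * (unitVol N ^ (1 - 1 / p) * c ^ (-(N / p) : ℝ) * gradNorm p φ) := by
  have hφ' : Continuous (fderiv ℝ φ) := h1.continuous_fderiv one_ne_zero
  have hK : IsCompact (Metric.closedBall (0 : Sp N) 1) := isCompact_closedBall 0 1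
  -- The ball slides from centre `y` to centre `x` at fixed radius `c`.
  have hd := fun t : ℝ => hasDerivAt_integral_affine h1 hc (P := fun z => y + c • z)
    (Q := fun _ => x - y) (by fun_prop) (by fun_prop) t
  have := norm_image_sub_le_of_norm_deriv_le_segment_01'
    (f := fun s : ℝ => ∫ z in Metric.closedBall (0 : Sp N) 1, φ (y + c • z + s • (x - y)))
    (C := ‖x - y‖ * (unitVol N ^ (1 - 1 / p) * c ^ (-(N / p) : ℝ) * gradNorm p φ))
    (fun t _ => (hd t).hasDerivWithinAt) ?_
  · convert this using 6
    · simp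
      abel_nf
  · intro t _
    calc _ ≤ ∫ z in Metric.closedBall (0 : Sp N) 1,
          ‖x - y‖ * ‖fderiv ℝ φ ((y + t • (x - y)) + c • z)‖ := by
          refine norm_integral_le_of_norm_le
            ((Continuous.continuousOn (by fun_prop)).integrableOn_compact hK)
            (Eventually.of_forall fun z => ?_)
          rw [mul_comm, add_right_comm]
          exact ContinuousLinearMap.le_opNorm _ _
      _ ≤ _ := by
          rw [integral_const_mul]
          exact mul_le_mul_of_nonneg_left (integral_fderiv_ball_le h1 hc hp _ hc0) (norm_nonneg _)

/-- Comparison of a ball average with the value at the center. -/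
theorem abs_integral_ball_sub_center_le (h1 : ContDiff ℝ 1 φ) (hc : HasCompactSupport φ) {p : ℝ}
    (hp : 1 < p) (hN : N < p) (x : Sp N) {c : ℝ} (hc0 : 0 < c) :
    |(∫ z in Metric.closedBall (0 : Sp N) 1, φ (x + c • z)) - unitVol N * φ x| ≤
      unitVol N ^ (1 - 1 / p) * gradNorm p φ * (c ^ (1 - N / p : ℝ) / (1 - N / p)) := by
  have hφ' : Continuous (fderiv ℝ φ) := h1.continuous_fderiv one_ne_zero
  have hK : IsCompact (Metric.closedBall (0 : Sp N) 1) := isCompact_closedBall 0 1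
  have hp0 : 0 < p := by linarith
  have hs0 : 0 < 1 - N / p := by rw [sub_pos, div_lt_one hp0]; exact hN
  set σ : ℝ := 1 - N / p with hσ
  set A := unitVol N ^ (1 - 1 / p) * gradNorm p φ with hA
  have hA0 : 0 ≤ A := mul_nonneg (Real.rpow_nonneg unitVol_pos.le _) (gradNorm_nonneg p)
  have hd := fun t : ℝ => hasDerivAt_integral_affine h1 hc (P := fun _ => x)
    (Q := fun z => z) (by fun_prop) (by fun_prop) t
  set F := fun s : ℝ => ∫ z in Metric.closedBall (0 : Sp N) 1, φ (x + s • z) with hF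
  -- Here the radius varies. The bound `A * t ^ (σ - 1)` on the derivative may blow up at `t = 0`,
  -- so it is integrated from `s > 0` only; `N < p` makes `σ` positive, hence the result is bounded
  -- as `s → 0`.
  have key : ∀ s ∈ Set.Ioo 0 c, ‖F c - F s‖ ≤ A * (c ^ σ / σ) := by
    intro s hs
    have hB : ∀ t ∈ Set.Icc s c,
        HasDerivAt (fun t => A * (t ^ σ / σ) - A * (s ^ σ / σ)) (A * t ^ (σ - 1)) t := by
      intro t ht
      have h3 := (((Real.hasDerivAt_rpow_const (x := t) (p := σ)
        (Or.inl (hs.1.trans_le ht.1).ne')).div_const σ).const_mul A).sub_const (A * (s ^ σ / σ))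
      have e : A * (σ * t ^ (σ - 1) / σ) = A * t ^ (σ - 1) := by
        rw [mul_div_cancel_left₀ _ hs0.ne']
      rwa [e] at h3
    have := image_norm_le_of_norm_deriv_right_le_deriv_boundary' (a := s) (b := c)
      (f := fun t => F t - F s) (f' := fun t => ∫ z in Metric.closedBall (0 : Sp N) 1,
        fderiv ℝ φ (x + t • z) z)
      (fun t _ => ((hd t).sub_const _).continuousAt.continuousWithinAt)
      (fun t _ => ((hd t).sub_const _).hasDerivWithinAt)
      (B := fun t => A * (t ^ σ / σ) - A * (s ^ σ / σ)) (B' := fun t => A * t ^ (σ - 1))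
      (by simp) (fun t ht => (hB t ht).continuousAt.continuousWithinAt)
      (fun t ht => (hB t (Set.Ico_subset_Icc_self ht)).hasDerivWithinAt) ?_
      (Set.right_mem_Icc.2 hs.2.le)
    · refine this.trans ?_
      have : 0 ≤ A * (s ^ σ / σ) := mul_nonneg hA0 (div_nonneg (Real.rpow_nonneg hs.1.le _) hs0.le)
      linarith
    · intro t ht
      have ht0 : 0 < t := hs.1.trans_le ht.1
      calc _ ≤ ∫ z in Metric.closedBall (0 : Sp N) 1, ‖fderiv ℝ φ (x + t • z)‖ := by
            refine norm_integral_le_of_norm_le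
              ((Continuous.continuousOn (by fun_prop)).integrableOn_compact hK)
              ((ae_restrict_iff' Metric.isClosed_closedBall.measurableSet).2
                (Eventually.of_forall fun z hz => ?_))
            refine (ContinuousLinearMap.le_opNorm _ _).trans
              (mul_le_of_le_one_right (norm_nonneg _) (by simpa using hz))
        _ ≤ _ := integral_fderiv_ball_le h1 hc hp _ ht0
        _ = _ := by rw [hA, hσ]; ring_nf
  have hF0 : F 0 = unitVol N * φ x := by simp [hF, unitVol]
  rw [← hF0]
  have hlim : Tendsto (fun s => ‖F c - F s‖) (𝓝[>] 0) (𝓝 ‖F c - F 0‖) :=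
    ((tendsto_const_nhds.sub (hd 0).continuousAt).norm).mono_left nhdsWithin_le_nhds
  exact le_of_tendsto hlim (by
    filter_upwards [Ioo_mem_nhdsGT hc0] with s hs using key s hs)

/-- Morrey's inequality for smooth compactly supported functions, in a form that is sharp
as `p → ∞`. -/
theorem abs_sub_le_gradNorm (h1 : ContDiff ℝ 1 φ) (hc : HasCompactSupport φ) {p : ℝ}
    (hp : 1 < p) (hN : 2 * N ≤ p) (x y : Sp N) {c : ℝ} (hc0 : 0 < c) :
    |φ x - φ y| ≤ (‖x - y‖ + 4 * c) * c ^ (-(N / p) : ℝ) * unitVol N ^ (-(1 / p)) *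
      gradNorm p φ := by
  have hp0 : 0 < p := by linarith
  have hNp : N < p := by
    rcases Nat.eq_zero_or_pos N with h | h
    · simp [h, hp0]
    · have : (0 : ℝ) < N := by exact_mod_cast h
      linarith
  -- Each passage from a ball average to its centre carries the factor `1 / (1 - N / p) ≤ 2`; the
  -- two passages together give the `4 * c`.
  have hs : (1 : ℝ) / 2 ≤ 1 - N / p := by
    rw [le_sub_comm, div_le_iff₀ hp0]; linarith
  have hω := unitVol_pos (N := N)
  set G := gradNorm p φ with hG
  have hG0 : 0 ≤ G := gradNorm_nonneg p
  have a1 := abs_integral_ball_sub_le h1 hc hp x y hc0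
  have a2 := abs_integral_ball_sub_center_le h1 hc hp hNp x hc0
  have a3 := abs_integral_ball_sub_center_le h1 hc hp hNp y hc0
  have e1 : c ^ (1 - N / p : ℝ) / (1 - N / p) ≤ 2 * c * c ^ (-(N / p) : ℝ) := by
    rw [div_le_iff₀ (by linarith), sub_eq_add_neg, Real.rpow_add hc0, Real.rpow_one]
    have : 0 < c * c ^ (-(N / p) : ℝ) := by positivity
    nlinarith
  have e2 : unitVol N ^ (1 - 1 / p) = unitVol N * unitVol N ^ (-(1 / p)) := by
    rw [sub_eq_add_neg, Real.rpow_add hω, Real.rpow_one]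
  have e3 : unitVol N ^ (1 - 1 / p) * G * (c ^ (1 - N / p : ℝ) / (1 - N / p)) ≤
      unitVol N ^ (1 - 1 / p) * G * (2 * c * c ^ (-(N / p) : ℝ)) := by gcongr
  have h4 : |unitVol N * φ x - unitVol N * φ y| ≤ unitVol N * ((‖x - y‖ + 4 * c) *
      c ^ (-(N / p) : ℝ) * unitVol N ^ (-(1 / p)) * G) := by
    have e4 : unitVol N * ((‖x - y‖ + 4 * c) * c ^ (-(N / p) : ℝ) * unitVol N ^ (-(1 / p)) * G) =
      ‖x - y‖ * (unitVol N ^ (1 - 1 / p) * c ^ (-(N / p) : ℝ) * G) +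
      2 * (unitVol N ^ (1 - 1 / p) * G * (2 * c * c ^ (-(N / p) : ℝ))) := by rw [e2]; ring
    rw [e4]
    rw [abs_le] at *
    constructor <;> linarith [a1.1, a1.2, a2.1, a2.2, a3.1, a3.2]
  rw [← mul_sub, abs_mul, abs_of_pos hω] at h4
  exact le_of_mul_le_mul_left h4 hω

end Morrey

/-! ### Weak gradients -/

section WeakGradient

variable {N : ℕ} {Ω : Set (Sp N)} {u : Sp N → ℝ} {φ : Sp N → ℝ}

theorem IsTestFun.eq_zero (hφ : IsTestFun Ω φ) {x : Sp N} (hx : x ∉ Ω) : φ x = 0 :=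
  image_eq_zero_of_notMem_tsupport fun h => hx (hφ.tsupport_subset h)

theorem IsTestFun.fderiv_eq_zero (hφ : IsTestFun Ω φ) {x : Sp N} (hx : x ∉ Ω) :
    fderiv ℝ φ x = 0 :=
  image_eq_zero_of_notMem_tsupport fun h => hx (hφ.tsupport_subset (tsupport_fderiv_subset ℝ h))

theorem IsTestFun.sub {ψ : Sp N → ℝ} (hφ : IsTestFun Ω φ) (hψ : IsTestFun Ω ψ) :
    IsTestFun Ω (fun x => φ x - ψ x) where
  contDiff := hφ.contDiff.sub hψ.contDiff
  hasCompactSupport := hφ.hasCompactSupport.sub hψ.hasCompactSupport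
  tsupport_subset := (tsupport_sub φ ψ).trans
    (Set.union_subset hφ.tsupport_subset hψ.tsupport_subset)

theorem IsTestFun.exists_lipschitzWith (hφ : IsTestFun Ω φ) : ∃ C, LipschitzWith C φ :=
  ContDiff.lipschitzWith_of_hasCompactSupport hφ.hasCompactSupport hφ.contDiff (by simp)

theorem IsTestFun.integrable_smul {E : Type*} [NormedAddCommGroup E] [NormedSpace ℝ E]
    {F : Sp N → E} (hφ : IsTestFun Ω φ) (hF : LocallyIntegrableOn F Ω) :
    Integrable fun x => φ x • F x := by
  have hK : IsCompact (tsupport φ) := hφ.hasCompactSupport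
  have h1 : IntegrableOn F (tsupport φ) := hF.integrableOn_compact_subset hφ.tsupport_subset hK
  have h2 : IntegrableOn (fun x => φ x • F x) (tsupport φ) :=
    h1.continuousOn_smul hφ.contDiff.continuous.continuousOn hK
  refine (integrableOn_iff_integrable_of_support_subset ?_).1 h2
  exact (Function.support_smul_subset_left φ F).trans (subset_tsupport φ)

theorem norm_gradient (x : Sp N) : ‖∇ u x‖ = ‖fderiv ℝ u x‖ := by simp [gradient]

/-- Weak gradients are unique up to null sets. -/
theorem IsWeakGradient.ae_eq {G G' : Sp N → Sp N} (hΩ : IsOpen Ω) (h : IsWeakGradient Ω u G)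
    (h' : IsWeakGradient Ω u G') : G =ᵐ[volume.restrict Ω] G' := by
  have hl := h.locallyIntegrableOn_grad.sub h'.locallyIntegrableOn_grad
  have := hΩ.ae_eq_zero_of_integral_contDiff_smul_eq_zero hl ?_
  · rw [Filter.EventuallyEq, ae_restrict_iff' hΩ.measurableSet]
    filter_upwards [this] with x hx hxΩ using sub_eq_zero.1 (hx hxΩ)
  · intro φ h1 h2 h3
    have hφ : IsTestFun Ω φ := ⟨h1, h2, h3⟩
    refine ext_inner_left ℝ fun v => ?_
    rw [← integral_inner (hφ.integrable_smul hl), inner_zero_right]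
    have e : ∀ F : Sp N → Sp N, LocallyIntegrableOn F Ω →
        Integrable (fun x => inner ℝ (F x) v * φ x) ∧
        ∫ x in Ω, inner ℝ (F x) v * φ x = ∫ x, inner ℝ (F x) v * φ x := by
      intro F hF
      constructor
      · have := (hφ.integrable_smul hF).const_inner (𝕜 := ℝ) v
        refine this.congr (Eventually.of_forall fun x => ?_)
        simp only [inner_smul_right, real_inner_comm]; ring
      · exact setIntegral_eq_integral_of_forall_compl_eq_zero fun x hx => by
          rw [hφ.eq_zero hx, mul_zero]
    obtain ⟨i1, e1⟩ := e G h.locallyIntegrableOn_grad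
    obtain ⟨i2, e2⟩ := e G' h'.locallyIntegrableOn_grad
    have e3 := h.integral_eq φ hφ v
    rw [h'.integral_eq φ hφ v, e1, e2, neg_inj] at e3
    calc _ = ∫ x, (inner ℝ (G x) v * φ x - inner ℝ (G' x) v * φ x) := by
          congr 1 with x
          simp only [Pi.sub_apply, inner_smul_right, inner_sub_right, real_inner_comm]
          ring
      _ = 0 := by rw [integral_sub i1 i2, e3, sub_self]

theorem isWeakGradient_weakGrad (h : ∃ G, IsWeakGradient Ω u G) :
    IsWeakGradient Ω u (weakGrad Ω u) := by
  rw [weakGrad, dif_pos h]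
  exact h.choose_spec

theorem measurable_gradient : Measurable (∇ u : Sp N → Sp N) :=
  (InnerProductSpace.toDual ℝ (Sp N)).symm.continuous.measurable.comp (measurable_fderiv ℝ u)

theorem norm_gradient_le {L : ℝ≥0} (hu : LipschitzWith L u) (x : Sp N) : ‖∇ u x‖ ≤ L := by
  rw [norm_gradient]
  exact norm_fderiv_le_of_lipschitz ℝ hu

/-- The pointwise gradient of a Lipschitz function is a weak gradient. -/
theorem isWeakGradient_gradient {L : ℝ≥0} (hu : LipschitzWith L u) :
    IsWeakGradient Ω u (∇ u) where
  locallyIntegrableOn := hu.continuous.locallyIntegrable.locallyIntegrableOn Ω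
  locallyIntegrableOn_grad := by
    refine LocallyIntegrable.locallyIntegrableOn ?_ Ω
    exact (locallyIntegrable_const (L : ℝ)).mono measurable_gradient.aestronglyMeasurable
      (Eventually.of_forall fun x => (norm_gradient_le hu x).trans (Real.le_norm_self _))
  integral_eq φ hφ v := by
    obtain ⟨C, hC⟩ := hφ.exists_lipschitzWith
    -- Integration by parts in the single direction `v`; Rademacher's theorem then identifies the
    -- line derivative of `u` with the inner product against its gradient almost everywhere.
    have h := hu.integral_lineDeriv_mul_eq (μ := volume) hC hφ.hasCompactSupport v
    have hd : ∀ x, lineDeriv ℝ φ x (-v) = -fderiv ℝ φ x v := fun x => by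
      rw [(hφ.contDiff.differentiable (by simp) x).lineDeriv_eq_fderiv, map_neg]
    have e1 : ∫ x, lineDeriv ℝ u x v * φ x = ∫ x, inner ℝ (∇ u x) v * φ x := by
      refine integral_congr_ae ?_
      filter_upwards [hu.ae_differentiableAt (μ := volume)] with x hx
      rw [hx.lineDeriv_eq_fderiv, inner_gradient_left]
    rw [setIntegral_eq_integral_of_forall_compl_eq_zero fun x hx => by
        rw [hφ.fderiv_eq_zero hx]; simp,
      setIntegral_eq_integral_of_forall_compl_eq_zero fun x hx => by
        rw [hφ.eq_zero hx, mul_zero], ← e1, h, ← integral_neg]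
    congr 1 with x
    rw [hd]; ring

theorem weakGrad_ae_eq_gradient {L : ℝ≥0} (hΩ : IsOpen Ω) (hu : LipschitzWith L u) :
    weakGrad Ω u =ᵐ[volume.restrict Ω] ∇ u :=
  (isWeakGradient_weakGrad ⟨_, isWeakGradient_gradient hu⟩).ae_eq hΩ (isWeakGradient_gradient hu)

/-- Lipschitz functions vanishing outside of a bounded domain belong to `W^{1,p}`. -/
theorem memW1_of_lipschitz {L : ℝ≥0} (hΩ : IsOpen Ω) (hb : Bornology.IsBounded Ω)
    (hu : LipschitzWith L u) (hc : HasCompactSupport u) (p : ℝ≥0∞) : MemW1 p Ω u where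
  memLp := (hu.continuous.memLp_of_hasCompactSupport hc).restrict Ω
  exists_grad := ⟨_, isWeakGradient_gradient hu⟩
  memLp_grad := by
    have : IsFiniteMeasure (volume.restrict Ω) := ⟨by simpa using hb.measure_lt_top⟩
    refine (MemLp.of_bound measurable_gradient.aestronglyMeasurable L
      (Eventually.of_forall (norm_gradient_le hu))).ae_eq ?_
    exact (weakGrad_ae_eq_gradient hΩ hu).symm

theorem IsTestFun.memW10 (hΩ : IsOpen Ω) (hb : Bornology.IsBounded Ω) (hφ : IsTestFun Ω φ)
    (p : ℝ) : MemW10 p Ω φ := by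
  obtain ⟨C, hC⟩ := hφ.exists_lipschitzWith
  refine ⟨memW1_of_lipschitz hΩ hb hC hφ.hasCompactSupport _, fun x hx => hφ.eq_zero hx,
    fun _ => φ, fun _ => hφ, ?_, ?_⟩
  · simp
  · have : (fun x => ∇ φ x - weakGrad Ω φ x) =ᵐ[volume.restrict Ω] 0 := by
      filter_upwards [weakGrad_ae_eq_gradient hΩ hC] with x hx
      simp [hx]
    simp [eLpNorm_congr_ae this]

/-- The weak gradient is almost everywhere the pointwise one, which the Lipschitz constant bounds.
This turns Lipschitz estimates on limits into gradient bounds. -/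
theorem lpNorm_weakGrad_top_le {L : ℝ≥0} (hΩ : IsOpen Ω) (hu : LipschitzWith L u) :
    lpNorm (weakGrad Ω u) ∞ (volume.restrict Ω) ≤ L := by
  have h := weakGrad_ae_eq_gradient hΩ hu
  rw [← toReal_eLpNorm (measurable_gradient.aestronglyMeasurable.congr h.symm), eLpNorm_congr_ae h]
  refine ENNReal.toReal_le_of_le_ofReal L.2 ?_
  rw [eLpNorm_exponent_top]
  exact eLpNormEssSup_le_of_ae_bound (Eventually.of_forall (norm_gradient_le hu))

theorem hasCompactSupport_of_eq_zero (hb : Bornology.IsBounded Ω) (h0 : ∀ x, x ∉ Ω → u x = 0) :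
    HasCompactSupport u :=
  HasCompactSupport.intro' hb.isCompact_closure isClosed_closure
    fun x hx => h0 x fun h => hx (subset_closure h)

theorem memW1Inf0_of_lipschitz {L : ℝ≥0} (hΩ : IsOpen Ω) (hb : Bornology.IsBounded Ω)
    (hu : LipschitzWith L u) (h0 : ∀ x, x ∉ Ω → u x = 0) : MemW1Inf0 Ω u :=
  ⟨memW1_of_lipschitz hΩ hb hu (hasCompactSupport_of_eq_zero hb h0) _, hu.continuous, h0⟩

open scoped Convolution

/-- Mollifications of a function with bounded weak gradient have bounded derivative. -/
theorem norm_fderiv_convolution_le {G : Sp N → Sp N} {L : ℝ} (hu : Continuous u)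
    (hG : IsWeakGradient Ω u G) (hL : ∀ᵐ x ∂volume.restrict Ω, ‖G x‖ ≤ L) (hL0 : 0 ≤ L)
    (ψ : ContDiffBump (0 : Sp N)) {z : Sp N} (hz : Metric.closedBall z ψ.rOut ⊆ Ω) :
    ∃ D : Sp N →L[ℝ] ℝ,
      HasFDerivAt (ψ.normed volume ⋆[ContinuousLinearMap.lsmul ℝ ℝ, volume] u) D z ∧ ‖D‖ ≤ L := by
  set ρ := ψ.normed volume with hρ
  have hρc : HasCompactSupport ρ := ψ.hasCompactSupport_normed
  have hρ1 : ContDiff ℝ ∞ ρ := ψ.contDiff_normed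
  have hul : LocallyIntegrable u volume := hu.locallyIntegrable
  have hD := hρc.hasFDerivAt_convolution_right (ContinuousLinearMap.lsmul ℝ ℝ).flip hul
    (hρ1.of_le (by simp)) z
  rw [convolution_flip] at hD
  refine ⟨_, hD, ?_⟩
  refine ContinuousLinearMap.opNorm_le_bound _ hL0 fun v => ?_
  rw [convolution_precompR_apply _ hul (hρc.fderiv ℝ) (hρ1.continuous_fderiv (by simp))]
  have ht : IsTestFun Ω (fun w => ρ (z - w)) := by
    have hs : tsupport (fun w => ρ (z - w)) ⊆ Metric.closedBall z ψ.rOut := by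
      refine closure_minimal (fun w hw => ?_) Metric.isClosed_closedBall
      have : z - w ∈ Function.support ρ := hw
      rw [hρ, ψ.support_normed_eq] at this
      have h2 : ‖z - w‖ < ψ.rOut := by simpa using this
      rw [Metric.mem_closedBall, dist_comm, dist_eq_norm]
      exact h2.le
    refine ⟨hρ1.comp (contDiff_const.sub contDiff_id), ?_, hs.trans hz⟩
    exact (isCompact_closedBall z ψ.rOut).of_isClosed_subset (isClosed_tsupport _) hs
  have hfd : ∀ w, fderiv ℝ (fun w => ρ (z - w)) w v = -fderiv ℝ ρ (z - w) v := fun w => by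
    have h1 : HasFDerivAt (fun w : Sp N => z - w) (-ContinuousLinearMap.id ℝ (Sp N)) w :=
      (hasFDerivAt_id w).const_sub z
    have h2 := ((hρ1.differentiable (by simp) (z - w)).hasFDerivAt).comp w h1
    rw [show (fun w => ρ (z - w)) = ρ ∘ fun w => z - w from rfl, h2.fderiv]
    simp
  -- The reflected mollifier `w ↦ ρ (z - w)` is an admissible test function, so the weak formulation
  -- moves the derivative from the mollifier to `u`.
  have e1 : (u ⋆[(ContinuousLinearMap.lsmul ℝ ℝ).flip, volume] fun a => fderiv ℝ ρ a v) z =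
      ∫ w in Ω, inner ℝ (G w) v * ρ (z - w) := by
    have := hG.integral_eq _ ht v
    rw [← neg_eq_iff_eq_neg, setIntegral_eq_integral_of_forall_compl_eq_zero fun x hx => by
        rw [ht.fderiv_eq_zero hx]; simp, ← integral_neg] at this
    rw [← this]
    simp only [convolution_def, hfd]
    congr 1 with w
    simp [mul_comm]
  rw [e1]
  have hint : Integrable (fun w => ρ (z - w)) :=
    ht.contDiff.continuous.integrable_of_hasCompactSupport ht.hasCompactSupport
  calc _ ≤ ∫ w in Ω, L * ‖v‖ * ρ (z - w) := by
        refine norm_integral_le_of_norm_le (hint.const_mul _).integrableOn ?_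
        filter_upwards [hL] with w hw
        rw [norm_mul, Real.norm_of_nonneg (ψ.nonneg_normed _)]
        refine mul_le_mul_of_nonneg_right ?_ (ψ.nonneg_normed _)
        exact (norm_inner_le_norm _ _).trans (mul_le_mul_of_nonneg_right hw (norm_nonneg _))
    _ ≤ ∫ w, L * ‖v‖ * ρ (z - w) := setIntegral_le_integral (hint.const_mul _)
        (Eventually.of_forall fun w => mul_nonneg (by positivity) (ψ.nonneg_normed _))
    _ = L * ‖v‖ := by
        rw [integral_const_mul, integral_sub_left_eq_self ρ volume z, ψ.integral_normed, mul_one]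

/-- A function with weak gradient bounded by `L` is `L`-Lipschitz along segments contained in the
domain. -/
theorem abs_sub_le_of_segment_subset {G : Sp N → Sp N} {L : ℝ} (hΩ : IsOpen Ω) (hu : Continuous u)
    (hG : IsWeakGradient Ω u G) (hL : ∀ᵐ x ∂volume.restrict Ω, ‖G x‖ ≤ L) (hL0 : 0 ≤ L)
    {x y : Sp N} (hxy : segment ℝ x y ⊆ Ω) : |u x - u y| ≤ L * ‖x - y‖ := by
  have hK : IsCompact (segment ℝ x y) := by
    rw [segment_eq_image_lineMap]
    exact isCompact_Icc.image AffineMap.lineMap_continuous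
  obtain ⟨δ, hδ0, hδ⟩ := hK.exists_cthickening_subset_open hΩ hxy
  have hd : ∀ n : ℕ, 0 < δ / (n + 1) := fun n => by positivity
  set ψ : ℕ → ContDiffBump (0 : Sp N) := fun n => ⟨δ / (n + 1) / 2, δ / (n + 1),
    half_pos (hd n), half_lt_self (hd n)⟩ with hψ
  have hr : Tendsto (fun n => (ψ n).rOut) atTop (𝓝 0) := by
    have := (tendsto_one_div_add_atTop_nhds_zero_nat (𝕜 := ℝ)).const_mul δ
    simpa [hψ, div_eq_mul_inv] using this
  have hlim := fun w => ContDiffBump.convolution_tendsto_right_of_continuous (μ := volume) hr hu w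
  refine le_of_tendsto ((hlim x).sub (hlim y)).abs (Eventually.of_forall fun n => ?_)
  have hz : ∀ z ∈ segment ℝ x y, ∃ D : Sp N →L[ℝ] ℝ,
      HasFDerivAt ((ψ n).normed volume ⋆[ContinuousLinearMap.lsmul ℝ ℝ, volume] u) D z ∧
        ‖D‖ ≤ L := by
    intro z hz
    refine norm_fderiv_convolution_le hu hG hL hL0 (ψ n) (Set.Subset.trans ?_ hδ)
    refine Set.Subset.trans (Metric.closedBall_subset_cthickening hz _)
      (Metric.cthickening_mono ?_ _)
    exact div_le_self hδ0.le (by linarith [(Nat.cast_nonneg n : (0 : ℝ) ≤ n)])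
  choose! D hD using hz
  exact Convex.norm_image_sub_le_of_norm_hasFDerivWithin_le (𝕜 := ℝ)
    (fun z hz => (hD z hz).1.hasFDerivWithinAt) (fun z hz => (hD z hz).2) (convex_segment x y)
    (right_mem_segment ℝ x y) (left_mem_segment ℝ x y)

/-- Functions in `W^{1,∞}_0`, extended by zero, are globally Lipschitz. -/
theorem MemW1Inf0.abs_sub_le (hΩ : IsOpen Ω) (hu : MemW1Inf0 Ω u) (x y : Sp N) :
    |u x - u y| ≤ lpNorm (weakGrad Ω u) ∞ (volume.restrict Ω) * ‖x - y‖ := by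
  set L := lpNorm (weakGrad Ω u) ∞ (volume.restrict Ω) with hL
  have hL0 : 0 ≤ L := lpNorm_nonneg
  have hseg : ∀ {x y : Sp N}, segment ℝ x y ⊆ Ω → |u x - u y| ≤ L * ‖x - y‖ := fun h =>
    abs_sub_le_of_segment_subset hΩ hu.continuous (isWeakGradient_weakGrad hu.exists_grad)
      (ae_le_lpNorm_exponent_top hu.memLp_grad) hL0 h
  have hout : ∀ {x w : Sp N}, w ∉ Ω → |u x| ≤ L * ‖x - w‖ := by
    intro x w hw
    by_cases hx : x ∈ Ω
    swap
    · rw [hu.eq_zero x hx, abs_zero]; positivity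
    set γ : ℝ → Sp N := fun t => AffineMap.lineMap (k := ℝ) x w t with hγ
    have hγc : Continuous γ := AffineMap.lineMap_continuous
    have hcl : IsCompact (Set.Icc (0 : ℝ) 1 ∩ γ ⁻¹' Ωᶜ) :=
      isCompact_Icc.inter_right (hΩ.isClosed_compl.preimage hγc)
    -- The first exit time from `Ω` on the way from `x` to `w`. Before it the segment bound applies,
    -- and at it `u` vanishes.
    obtain ⟨t, ⟨ht, htΩ⟩, hmin⟩ := hcl.exists_isLeast
      ⟨1, Set.right_mem_Icc.2 zero_le_one, by simpa [hγ] using hw⟩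
    have hγs : ∀ s, x - γ s = s • (x - w) := fun s => by
      simp only [hγ, AffineMap.lineMap_apply, vsub_eq_sub, vadd_eq_add]
      rw [← neg_sub x w, smul_neg]; abel
    have ht0 : 0 < t := by
      refine lt_of_le_of_ne ht.1 fun h => htΩ ?_
      rw [← h]; simpa [hγ] using hx
    have h1 : ∀ s ∈ Set.Ioo 0 t, |u x - u (γ s)| ≤ L * ‖x - w‖ := by
      intro s hs
      have hs' : segment ℝ x (γ s) ⊆ Ω := by
        intro z hz
        rw [segment_eq_image_lineMap] at hz
        obtain ⟨r, hr, rfl⟩ := hz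
        have e : AffineMap.lineMap x (γ s) r = γ (r * s) := by
          simp only [hγ, AffineMap.lineMap_apply, vsub_eq_sub, vadd_eq_add, add_sub_cancel_right,
            smul_smul]
        rw [e]
        by_contra hcon
        have hrs : r * s ≤ s := mul_le_of_le_one_left hs.1.le hr.2
        have := hmin ⟨⟨mul_nonneg hr.1 hs.1.le, hrs.trans (hs.2.le.trans ht.2)⟩, hcon⟩
        linarith [hs.2]
      refine (hseg hs').trans (mul_le_mul_of_nonneg_left ?_ hL0)
      rw [hγs, norm_smul, Real.norm_of_nonneg hs.1.le]
      exact mul_le_of_le_one_left (norm_nonneg _) (hs.2.le.trans ht.2)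
    have h2 : Tendsto (fun s => |u x - u (γ s)|) (𝓝[<] t) (𝓝 |u x - u (γ t)|) :=
      (Continuous.tendsto (continuous_const.sub (hu.continuous.comp hγc)).abs t).mono_left
        nhdsWithin_le_nhds
    rw [hu.eq_zero _ htΩ, sub_zero] at h2
    exact le_of_tendsto h2 (by
      filter_upwards [Ioo_mem_nhdsLT ht0] with s hs using h1 s hs)
  by_cases h : segment ℝ x y ⊆ Ω
  · exact hseg h
  -- At a point `w` of the segment outside `Ω` the two one-sided bounds add up without loss, since
  -- the distances to `w` sum to `‖x - y‖`.
  · obtain ⟨w, hw, hwΩ⟩ := Set.not_subset.1 h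
    have e := dist_add_dist_of_mem_segment hw
    rw [dist_eq_norm, dist_eq_norm, dist_eq_norm] at e
    have a1 := hout (x := x) hwΩ
    have a2 := hout (x := y) hwΩ
    rw [norm_sub_rev y w] at a2
    calc |u x - u y| ≤ |u x| + |u y| := abs_sub _ _
      _ ≤ L * ‖x - w‖ + L * ‖w - y‖ := add_le_add a1 a2
      _ = _ := by rw [← mul_add, e]

theorem MemW1Inf0.lipschitzWith (hΩ : IsOpen Ω) (hu : MemW1Inf0 Ω u) :
    LipschitzWith (lpNorm (weakGrad Ω u) ∞ (volume.restrict Ω)).toNNReal u :=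
  LipschitzWith.of_dist_le_mul fun x y => by
    rw [Real.coe_toNNReal _ lpNorm_nonneg, Real.dist_eq, dist_eq_norm]
    exact hu.abs_sub_le hΩ x y

end WeakGradient

/-! ### Continuous representatives of Sobolev functions -/

section Representative

variable {N : ℕ} {Ω : Set (Sp N)} {u : Sp N → ℝ} {φ ψ : Sp N → ℝ}

theorem IsTestFun.differentiable (hφ : IsTestFun Ω φ) : Differentiable ℝ φ :=
  hφ.contDiff.differentiable (by simp)

theorem IsTestFun.contDiff_one (hφ : IsTestFun Ω φ) : ContDiff ℝ 1 φ :=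
  hφ.contDiff.of_le (by simp)

theorem IsTestFun.gradNorm_eq (hφ : IsTestFun Ω φ) {p : ℝ} (hp : 0 < p) :
    gradNorm p φ = (eLpNorm (∇ φ) (ENNReal.ofReal p) (volume.restrict Ω)).toReal := by
  rw [toReal_eLpNorm measurable_gradient.aestronglyMeasurable,
    lpNorm_eq_integral_norm_rpow_toReal (by simpa using hp) ENNReal.ofReal_ne_top
      measurable_gradient.aestronglyMeasurable, ENNReal.toReal_ofReal hp.le, gradNorm, one_div,
    setIntegral_eq_integral_of_forall_compl_eq_zero]
  · simp_rw [norm_gradient]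
  · intro x hx
    rw [norm_gradient, hφ.fderiv_eq_zero hx, norm_zero, Real.zero_rpow hp.ne']

theorem IsTestFun.memLp_gradient (hφ : IsTestFun Ω φ) (p : ℝ≥0∞) :
    MemLp (∇ φ) p (volume.restrict Ω) := by
  have h1 : Continuous (∇ φ) := (InnerProductSpace.toDual ℝ (Sp N)).symm.continuous.comp
    (hφ.contDiff_one.continuous_fderiv one_ne_zero)
  have h2 : HasCompactSupport (∇ φ) :=
    (hφ.hasCompactSupport.fderiv (𝕜 := ℝ)).comp_left (map_zero _)
  exact (h1.memLp_of_hasCompactSupport h2).restrict Ω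

theorem gradient_fun_sub (hφ : Differentiable ℝ φ) (hψ : Differentiable ℝ ψ) (x : Sp N) :
    ∇ (fun x => φ x - ψ x) x = ∇ φ x - ∇ ψ x := by
  rw [gradient, gradient, gradient, fderiv_fun_sub (hφ x) (hψ x), map_sub]

/-- The point `w` is a common zero of all functions considered, so it converts Morrey's oscillation
bound into a sup bound. The dimension must be positive for the whole space to be unbounded. -/
theorem exists_notMem_of_isBounded (hN : 1 ≤ N) (hb : Bornology.IsBounded Ω) :
    ∃ D : ℝ, 0 ≤ D ∧ ∃ w, w ∉ Ω ∧ ∀ x ∈ Ω, ‖x - w‖ ≤ D := by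
  have : Nonempty (Fin N) := ⟨⟨0, hN⟩⟩
  obtain ⟨w, hw⟩ : ∃ w, w ∉ Ω := by
    by_contra! h
    exact NormedSpace.unbounded_univ ℝ (Sp N) (by rwa [Set.eq_univ_of_forall h] at hb)
  obtain ⟨D, hD⟩ := hb.subset_closedBall w
  refine ⟨max D 0, le_max_right _ _, w, hw, fun x hx => ?_⟩
  have := hD hx
  rw [Metric.mem_closedBall, dist_eq_norm] at this
  exact this.trans (le_max_left _ _)

/-- Morrey's embedding of `W^{1,p}_0(Ω)`. -/
theorem MemW10.exists_continuous (hN : 1 ≤ N) (hΩ : IsOpen Ω) (hb : Bornology.IsBounded Ω) {p : ℝ}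
    (hp : 1 < p) (hNp : 2 * N ≤ p) (hu : MemW10 p Ω u) :
    ∃ v : Sp N → ℝ, Continuous v ∧ (∀ x, x ∉ Ω → v x = 0) ∧ v =ᵐ[volume] u ∧
      ∀ x y, ∀ c : ℝ, 0 < c → |v x - v y| ≤ (‖x - y‖ + 4 * c) * c ^ (-(N / p) : ℝ) *
        unitVol N ^ (-(1 / p)) *
        lpNorm (weakGrad Ω u) (ENNReal.ofReal p) (volume.restrict Ω) := by
  have hp0 : 0 < p := by linarith
  have hω := unitVol_pos (N := N)
  obtain ⟨D, hD0, w, hw, hD⟩ := exists_notMem_of_isBounded hN hb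
  obtain ⟨φ, hφ, hφu, hφG⟩ := hu.approx
  set P := ENNReal.ofReal p with hP
  have hP1 : 1 ≤ P := by rw [hP, ENNReal.one_le_ofReal]; exact hp.le
  set μ := (volume : Measure (Sp N)).restrict Ω with hμ
  set G := weakGrad Ω u with hG
  have hGm : MemLp G P μ := hu.memLp_grad
  set b : ℕ → ℝ := fun n => (eLpNorm (fun x => ∇ (φ n) x - G x) P μ).toReal with hb'
  have hb0 : Tendsto b atTop (𝓝 0) := by
    have := (ENNReal.tendsto_toReal ENNReal.zero_ne_top).comp hφG
    rwa [ENNReal.toReal_zero] at this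
  have hd : ∀ n, MemLp (fun x => ∇ (φ n) x - G x) P μ := fun n =>
    ((hφ n).memLp_gradient P).sub hGm
  set K : ℝ := (D + 4) * unitVol N ^ (-(1 / p)) with hK
  have hK0 : 0 ≤ K := by positivity
  -- Morrey's inequality with radius `c = 1`, comparing with the zero at `w`.
  have hsup : ∀ ψ, IsTestFun Ω ψ → ∀ x, |ψ x| ≤ K * gradNorm p ψ := by
    intro ψ hψ x
    by_cases hx : x ∈ Ω
    · have := abs_sub_le_gradNorm hψ.contDiff_one hψ.hasCompactSupport hp hNp x w one_pos
      rw [hψ.eq_zero hw, sub_zero, Real.one_rpow, mul_one, mul_one] at this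
      refine this.trans ?_
      have := gradNorm_nonneg (φ := ψ) p
      rw [hK]
      gcongr
      exact hD x hx
    · rw [hψ.eq_zero hx, abs_zero]
      exact mul_nonneg hK0 (gradNorm_nonneg p)
  have hdiff : ∀ n m x, |φ n x - φ m x| ≤ K * (b n + b m) := by
    intro n m x
    refine (hsup _ ((hφ n).sub (hφ m)) x).trans (mul_le_mul_of_nonneg_left ?_ hK0)
    rw [((hφ n).sub (hφ m)).gradNorm_eq hp0, hb',
      ← ENNReal.toReal_add (hd n).eLpNorm_ne_top (hd m).eLpNorm_ne_top]
    refine ENNReal.toReal_mono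
      (ENNReal.add_ne_top.2 ⟨(hd n).eLpNorm_ne_top, (hd m).eLpNorm_ne_top⟩) ?_
    have e : ∇ (fun x => φ n x - φ m x) =
        (fun x => ∇ (φ n) x - G x) - fun x => ∇ (φ m) x - G x := by
      ext1 x
      rw [gradient_fun_sub (hφ n).differentiable (hφ m).differentiable]
      simp
    rw [e]
    exact eLpNorm_sub_le (hd n).1 (hd m).1 hP1
  have hnorm : ∀ n, gradNorm p (φ n) ≤ b n + lpNorm G P μ := by
    intro n
    rw [(hφ n).gradNorm_eq hp0, hb', ← toReal_eLpNorm hGm.1,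
      ← ENNReal.toReal_add (hd n).eLpNorm_ne_top hGm.eLpNorm_ne_top]
    refine ENNReal.toReal_mono (ENNReal.add_ne_top.2 ⟨(hd n).eLpNorm_ne_top, hGm.eLpNorm_ne_top⟩) ?_
    have e : ∇ (φ n) = (fun x => ∇ (φ n) x - G x) + G := by ext1 x; simp
    conv_lhs => rw [e]
    exact eLpNorm_add_le (hd n).1 hGm.1 hP1
  have hcau : UniformCauchySeqOn φ atTop Set.univ := by
    rw [Metric.uniformCauchySeqOn_iff]
    intro ε hε
    have : Tendsto (fun n => K * b n) atTop (𝓝 0) := by simpa using hb0.const_mul K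
    obtain ⟨n0, hn0⟩ := eventually_atTop.1 (this.eventually (gt_mem_nhds (half_pos hε)))
    refine ⟨n0, fun m hm n hn x _ => ?_⟩
    rw [Real.dist_eq]
    have := hdiff m n x
    have h1 := hn0 m hm
    have h2 := hn0 n hn
    linarith
  have hlim : ∀ x, ∃ l, Tendsto (fun n => φ n x) atTop (𝓝 l) := fun x =>
    cauchySeq_tendsto_of_complete (hcau.cauchySeq (Set.mem_univ x))
  choose v hv using hlim
  have hunif : TendstoUniformly φ v atTop := by
    rw [← tendstoUniformlyOn_univ]
    exact hcau.tendstoUniformlyOn_of_tendsto fun x _ => hv x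
  have hv0 : ∀ x, x ∉ Ω → v x = 0 := fun x hx =>
    tendsto_nhds_unique (hv x) (by simp [fun n => (hφ n).eq_zero hx])
  refine ⟨v, hunif.continuous (Eventually.of_forall fun n => (hφ n).contDiff.continuous).frequently,
    hv0, ?_, ?_⟩
  -- Convergence in `L^p` gives almost everywhere convergence of a subsequence, which identifies the
  -- uniform limit with `u`.
  · have h1 : TendstoInMeasure μ φ atTop u :=
      tendstoInMeasure_of_tendsto_eLpNorm (p := P) (by positivity)
        (fun n => (hφ n).contDiff.continuous.aestronglyMeasurable) hu.memLp.1 hφu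
    obtain ⟨ns, hns, hae⟩ := h1.exists_seq_tendsto_ae
    rw [hμ, ae_restrict_iff' hΩ.measurableSet] at hae
    filter_upwards [hae] with x hx
    by_cases hxΩ : x ∈ Ω
    · exact tendsto_nhds_unique ((hv x).comp hns.tendsto_atTop) (hx hxΩ)
    · rw [hv0 x hxΩ, hu.eq_zero x hxΩ]
  · intro x y c hc
    have h1 : Tendsto (fun n => |φ n x - φ n y|) atTop (𝓝 |v x - v y|) :=
      ((hv x).sub (hv y)).abs
    have h2 : Tendsto (fun n => (‖x - y‖ + 4 * c) * c ^ (-(N / p) : ℝ) *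
        unitVol N ^ (-(1 / p)) * (b n + lpNorm G P μ)) atTop
        (𝓝 ((‖x - y‖ + 4 * c) * c ^ (-(N / p) : ℝ) * unitVol N ^ (-(1 / p)) *
          (0 + lpNorm G P μ))) := (hb0.add_const _).const_mul _
    rw [zero_add] at h2
    refine le_of_tendsto_of_tendsto' h1 h2 fun n => ?_
    refine (abs_sub_le_gradNorm (hφ n).contDiff_one (hφ n).hasCompactSupport hp hNp x y hc).trans ?_
    exact mul_le_mul_of_nonneg_left (hnorm n) (by positivity)

end Representative

/-! ### The energy and the first eigenvalue -/

section Energy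

variable {N : ℕ} {Ω : Set (Sp N)} {J : Sp N → ℝ} {u v : Sp N → ℝ}

/-- The integrand of the nonlocal energy. -/
noncomputable def nonlocalDensity (J : Sp N → ℝ) (p : ℝ) (v : Sp N → ℝ) (z : Sp N × Sp N) : ℝ :=
  J (z.1 - z.2) * |v z.1 - v z.2| ^ p

theorem nonlocalDensity_nonneg (hJ : IsKernel J) (p : ℝ) (v : Sp N → ℝ) (z : Sp N × Sp N) :
    0 ≤ nonlocalDensity J p v z :=
  mul_nonneg (hJ.nonneg _) (Real.rpow_nonneg (abs_nonneg _) _)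

theorem continuous_nonlocalDensity (hJ : IsKernel J) {p : ℝ} (hp : 0 < p) (hv : Continuous v) :
    Continuous (nonlocalDensity J p v) := by
  have := hJ.continuous
  refine Continuous.mul (by fun_prop) (Continuous.rpow_const (by fun_prop) fun _ => Or.inr hp.le)

/-- A nonzero density forces one of the two points into `Ω` and their difference into the support of
`J`. The compact set serves all `p` and `v` at once. -/
theorem exists_isCompact_nonlocalDensity_eq_zero (hJ : IsKernel J) (hb : Bornology.IsBounded Ω) :
    ∃ K : Set (Sp N × Sp N), IsCompact K ∧ ∀ p : ℝ, 0 < p → ∀ v : Sp N → ℝ,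
      (∀ x, x ∉ Ω → v x = 0) → ∀ z, z ∉ K → nonlocalDensity J p v z = 0 := by
  obtain ⟨R, hR⟩ := hb.subset_closedBall 0
  obtain ⟨R', hR'⟩ := hJ.hasCompactSupport.isCompact.isBounded.subset_closedBall 0
  refine ⟨Metric.closedBall 0 (R + |R'|) ×ˢ Metric.closedBall 0 (R + |R'|),
    (isCompact_closedBall _ _).prod (isCompact_closedBall _ _), fun p hp v hv z hz => ?_⟩
  by_contra hne
  rw [nonlocalDensity, mul_eq_zero, not_or] at hne
  obtain ⟨h1, h2⟩ := hne
  have a1 : ‖z.1 - z.2‖ ≤ |R'| := by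
    have := hR' (subset_tsupport J h1)
    rw [mem_closedBall_zero_iff] at this
    exact this.trans (le_abs_self _)
  have a2 : ‖z.1‖ ≤ R ∨ ‖z.2‖ ≤ R := by
    by_contra! h
    refine h2 ?_
    rw [hv z.1 fun h' => (h.1.trans_le (by simpa using hR h')).false,
      hv z.2 fun h' => (h.2.trans_le (by simpa using hR h')).false, sub_zero, abs_zero,
      Real.zero_rpow hp.ne']
  refine hz ?_
  rw [Set.mem_prod, mem_closedBall_zero_iff, mem_closedBall_zero_iff]
  have b1 := norm_sub_norm_le z.1 z.2
  have b2 := norm_sub_norm_le z.2 z.1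
  rw [norm_sub_rev z.2] at b2
  have b3 := abs_nonneg R'
  rcases a2 with h | h <;> constructor <;> linarith

theorem integrable_nonlocalDensity (hJ : IsKernel J) (hb : Bornology.IsBounded Ω) {p : ℝ}
    (hp : 0 < p) (hv : Continuous v) (h0 : ∀ x, x ∉ Ω → v x = 0) :
    Integrable (nonlocalDensity J p v) := by
  obtain ⟨K, hK, h⟩ := exists_isCompact_nonlocalDensity_eq_zero hJ hb
  exact (continuous_nonlocalDensity hJ hp hv).integrable_of_hasCompactSupport
    (HasCompactSupport.intro hK fun z hz => h p hp v h0 z hz)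

theorem rpow_sub_two_mul {a p : ℝ} (ha : 0 ≤ a) (hp : 2 < p) : a ^ (p - 2) * (a * a) = a ^ p := by
  rcases ha.eq_or_lt with rfl | h
  · rw [Real.zero_rpow (by linarith), Real.zero_rpow (by linarith), zero_mul]
  · rw [← pow_two, ← Real.rpow_natCast, ← Real.rpow_add h]
    norm_num

/-- The energy of a function with a continuous representative. -/
theorem energy_self_eq (hJ : IsKernel J) (hb : Bornology.IsBounded Ω) {p : ℝ} (hp : 2 < p)
    (hv : Continuous v) (h0 : ∀ x, x ∉ Ω → v x = 0) (huv : v =ᵐ[volume] u) :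
    energy J Ω p u u = (∫ x in Ω, ‖weakGrad Ω u x‖ ^ p) + ∫ z, nonlocalDensity J p v z := by
  unfold energy
  congr 1
  · congr 1 with x
    rw [real_inner_self_eq_norm_mul_norm, rpow_sub_two_mul (norm_nonneg _) hp]
  · rw [Measure.volume_eq_prod,
      integral_prod _ (integrable_nonlocalDensity hJ hb (by linarith) hv h0)]
    refine integral_congr_ae ?_
    filter_upwards [huv] with x hx
    refine integral_congr_ae ?_
    filter_upwards [huv] with y hy
    rw [nonlocalDensity, ← hx, ← hy, ← rpow_sub_two_mul (abs_nonneg _) hp, abs_mul_abs_self]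
    ring

theorem energy_self_nonneg (hJ : IsKernel J) (p : ℝ) (u : Sp N → ℝ) : 0 ≤ energy J Ω p u u := by
  refine add_nonneg (integral_nonneg fun x => ?_) (integral_nonneg fun x => integral_nonneg
    fun y => ?_)
  · exact mul_nonneg (Real.rpow_nonneg (norm_nonneg _) _) real_inner_self_nonneg
  · simp only [Pi.zero_apply]
    rw [mul_assoc]
    exact mul_nonneg (mul_nonneg (hJ.nonneg _) (Real.rpow_nonneg (abs_nonneg _) _))
      (mul_self_nonneg _)

theorem rayleigh_nonneg (hJ : IsKernel J) (p : ℝ) (u : Sp N → ℝ) :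
    0 ≤ energy J Ω p u u / ∫ x in Ω, |u x| ^ p :=
  div_nonneg (energy_self_nonneg hJ p u)
    (integral_nonneg fun _ => Real.rpow_nonneg (abs_nonneg _) _)

theorem lambdaOne_nonneg (hJ : IsKernel J) (p : ℝ) : 0 ≤ lambdaOne J Ω p := by
  refine Real.sInf_nonneg ?_
  rintro t ⟨u, -, -, rfl⟩
  exact rayleigh_nonneg hJ p u

theorem lambdaOne_le (hJ : IsKernel J) {p : ℝ} (hu : MemW10 p Ω u) (h0 : ¬ u =ᵐ[volume] 0) :
    lambdaOne J Ω p ≤ energy J Ω p u u / ∫ x in Ω, |u x| ^ p := by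
  refine csInf_le ⟨0, ?_⟩ ⟨u, hu, h0, rfl⟩
  rintro t ⟨u, -, -, rfl⟩
  exact rayleigh_nonneg hJ p u

/-- The point is that `A`, the volume of the compact set times a bound for `J`, does not depend on
`p`, so its `p`-th root tends to a harmless limit. -/
theorem exists_nonlocal_le (hJ : IsKernel J) (hb : Bornology.IsBounded Ω) :
    ∃ A : ℝ, 0 ≤ A ∧ ∀ (p S : ℝ) (v : Sp N → ℝ), 0 < p → 0 ≤ S → Continuous v →
      (∀ x, x ∉ Ω → v x = 0) → (∀ x y, x - y ∈ tsupport J → |v x - v y| ≤ S) →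
      ∫ z, nonlocalDensity J p v z ≤ A * S ^ p := by
  obtain ⟨K, hK, h⟩ := exists_isCompact_nonlocalDensity_eq_zero hJ hb
  obtain ⟨C, hC⟩ := hJ.continuous.bounded_above_of_compact_support hJ.hasCompactSupport
  have hC0 : 0 ≤ C := (norm_nonneg _).trans (hC 0)
  refine ⟨volume.real K * C, by positivity, fun p S v hp hS hv h0 hvS => ?_⟩
  have hint := integrable_nonlocalDensity hJ hb hp hv h0
  rw [← setIntegral_eq_integral_of_forall_compl_eq_zero fun z hz => h p hp v h0 z hz]
  calc _ ≤ ∫ z in K, C * S ^ p := by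
        refine setIntegral_mono hint.integrableOn (integrableOn_const hK.measure_lt_top.ne)
          fun z => ?_
        by_cases hz : z.1 - z.2 ∈ tsupport J
        · exact mul_le_mul ((le_abs_self _).trans (hC _))
            (Real.rpow_le_rpow (abs_nonneg _) (hvS _ _ hz) hp.le)
            (Real.rpow_nonneg (abs_nonneg _) _) hC0
        · simp only [nonlocalDensity]
          rw [image_eq_zero_of_notMem_tsupport hz, zero_mul]
          positivity
    _ = _ := by
        rw [setIntegral_const, smul_eq_mul]; ring

theorem integral_norm_weakGrad_le_energy (hJ : IsKernel J) (hb : Bornology.IsBounded Ω) {p : ℝ}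
    (hp : 2 < p) (hv : Continuous v) (h0 : ∀ x, x ∉ Ω → v x = 0) (huv : v =ᵐ[volume] u) :
    ∫ x in Ω, ‖weakGrad Ω u x‖ ^ p ≤ energy J Ω p u u := by
  rw [energy_self_eq hJ hb hp hv h0 huv]
  exact le_add_of_nonneg_right (integral_nonneg (nonlocalDensity_nonneg hJ p v))

theorem nonlocal_le_energy (hJ : IsKernel J) (hb : Bornology.IsBounded Ω) {p : ℝ}
    (hp : 2 < p) (hv : Continuous v) (h0 : ∀ x, x ∉ Ω → v x = 0) (huv : v =ᵐ[volume] u) :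
    ∫ z, nonlocalDensity J p v z ≤ energy J Ω p u u := by
  rw [energy_self_eq hJ hb hp hv h0 huv]
  exact le_add_of_nonneg_left (integral_nonneg fun _ => Real.rpow_nonneg (norm_nonneg _) _)

theorem lpNorm_weakGrad_le (hJ : IsKernel J) (hb : Bornology.IsBounded Ω) {p M : ℝ}
    (hp : 2 < p) (hM : 0 ≤ M) (hu : MemW10 p Ω u) (hv : Continuous v)
    (h0 : ∀ x, x ∉ Ω → v x = 0) (huv : v =ᵐ[volume] u) (hE : energy J Ω p u u ≤ M ^ p) :
    lpNorm (weakGrad Ω u) (ENNReal.ofReal p) (volume.restrict Ω) ≤ M := by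
  have hp0 : 0 < p := by linarith
  rw [lpNorm_eq_integral_norm_rpow_toReal (by simpa using hp0) ENNReal.ofReal_ne_top
      hu.memLp_grad.1, ENNReal.toReal_ofReal hp0.le]
  refine (Real.rpow_inv_le_iff_of_pos
    (integral_nonneg fun _ => Real.rpow_nonneg (norm_nonneg _) _) hM hp0).2 ?_
  exact (integral_norm_weakGrad_le_energy hJ hb hp hv h0 huv).trans hE

end Energy

/-! ### Compactness of sequences with bounded Rayleigh quotients -/

section Compactness

variable {N : ℕ} {Ω : Set (Sp N)} {J : Sp N → ℝ}

/-- Arzelà–Ascoli for functions vanishing outside of a bounded set. -/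
theorem exists_subseq_tendstoUniformly (hb : Bornology.IsBounded Ω) {V : ℕ → Sp N → ℝ} {C : ℝ}
    (h0 : ∀ n x, x ∉ Ω → V n x = 0) (hC : ∀ n x, |V n x| ≤ C) (hV : Equicontinuous V) :
    ∃ σ : ℕ → ℕ, StrictMono σ ∧ ∃ u : Sp N → ℝ, Continuous u ∧ (∀ x, x ∉ Ω → u x = 0) ∧
      TendstoUniformly (fun n => V (σ n)) u atTop := by
  have hK : IsCompact (closure Ω) := hb.isCompact_closure
  have : CompactSpace (closure Ω) := isCompact_iff_compactSpace.1 hK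
  set F : ℕ → BoundedContinuousFunction (closure Ω) ℝ := fun n =>
    BoundedContinuousFunction.mkOfCompact ⟨fun x => V n x, (hV.continuous n).comp
      continuous_subtype_val⟩ with hF
  have hcomp : IsCompact (closure (Set.range F)) := by
    refine BoundedContinuousFunction.arzela_ascoli (Metric.closedBall 0 C)
      (isCompact_closedBall _ _) _ ?_ ?_
    · rintro f x ⟨n, rfl⟩
      rw [mem_closedBall_zero_iff]
      exact hC n x
    · intro x
      rw [Metric.equicontinuousAt_iff]
      intro ε hε
      obtain ⟨δ, hδ, h⟩ := Metric.equicontinuousAt_iff.1 (hV x) ε hε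
      refine ⟨δ, hδ, fun y hy => ?_⟩
      rintro ⟨_, n, rfl⟩
      exact h y hy n
  obtain ⟨f, -, σ, hσ, hlim⟩ := hcomp.tendsto_subseq fun n => subset_closure (Set.mem_range_self n)
  rw [BoundedContinuousFunction.tendsto_iff_tendstoUniformly, Metric.tendstoUniformly_iff] at hlim
  classical
  -- Every `V n` vanishes off `closure Ω`, so extending the limit by zero keeps the convergence
  -- uniform on the whole space.
  set u : Sp N → ℝ := fun x => if h : x ∈ closure Ω then f ⟨x, h⟩ else 0 with hu
  have hunif : TendstoUniformly (fun n => V (σ n)) u atTop := by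
    rw [Metric.tendstoUniformly_iff]
    intro ε hε
    filter_upwards [hlim ε hε] with n hn x
    by_cases hx : x ∈ closure Ω
    · simp only [hu, dif_pos hx]
      exact hn ⟨x, hx⟩
    · simp only [hu, dif_neg hx]
      rw [h0 _ _ fun h => hx (subset_closure h), dist_self]
      exact hε
  refine ⟨σ, hσ, u, hunif.continuous (Eventually.of_forall fun n => hV.continuous _).frequently,
    fun x hx => ?_, hunif⟩
  exact tendsto_nhds_unique (hunif.tendsto_at x) (by simp [fun n => h0 (σ n) x hx])

/-- Bounds the volume factor in Morrey's inequality uniformly in the exponent. -/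
theorem rpow_neg_le_max {a s : ℝ} (ha : 0 < a) (hs0 : 0 ≤ s) (hs1 : s ≤ 1) :
    a ^ (-s) ≤ max 1 a⁻¹ := by
  rcases le_total 1 a with h | h
  · exact (Real.rpow_le_one_of_one_le_of_nonpos h (neg_nonpos.2 hs0)).trans (le_max_left _ _)
  · refine le_trans ?_ (le_max_right _ _)
    rw [← Real.rpow_neg_one]
    exact Real.rpow_le_rpow_of_exponent_ge ha h (neg_le_neg hs1)

theorem tendsto_rpow_div_atTop {ι : Type*} {l : Filter ι} {a b : ℝ} (ha : 0 < a) {q : ι → ℝ}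
    (hq : Tendsto q l atTop) : Tendsto (fun n => a ^ (b / q n)) l (𝓝 1) := by
  have h := (Real.continuousAt_const_rpow (a := a) (b := 0) ha.ne').tendsto.comp
    (hq.const_div_atTop b)
  rwa [Real.rpow_zero] at h

/-- Passing to the limit in `q`-th powers as `q → ∞`. -/
theorem le_of_mul_rpow_le {κ s ℓ : ℝ} (hκ : 0 < κ) (hs : 0 ≤ s) {q M : ℕ → ℝ}
    (hq : Tendsto q atTop atTop) (hM : Tendsto M atTop (𝓝 ℓ))
    (h : ∀ᶠ n in atTop, 0 ≤ M n ∧ κ * s ^ q n ≤ M n ^ q n) : s ≤ ℓ := by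
  have h1 : Tendsto (fun n => κ ^ (1 / q n) * s) atTop (𝓝 (1 * s)) :=
    (tendsto_rpow_div_atTop hκ hq).mul_const s
  rw [one_mul] at h1
  refine le_of_tendsto_of_tendsto h1 hM ?_
  filter_upwards [h, hq.eventually_gt_atTop 0] with n hn hq0
  have h2 := Real.rpow_le_rpow (mul_nonneg hκ.le (Real.rpow_nonneg hs _)) hn.2
    (one_div_nonneg.2 hq0.le)
  rw [Real.mul_rpow hκ.le (Real.rpow_nonneg hs _), ← Real.rpow_mul hs, ← Real.rpow_mul hn.1,
    mul_one_div_cancel hq0.ne', Real.rpow_one, Real.rpow_one] at h2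
  exact h2

/-- Uniform bounds and equicontinuity from Morrey's inequality. -/
theorem equicontinuous_of_morrey (hN : 1 ≤ N) (hb : Bornology.IsBounded Ω) {V : ℕ → Sp N → ℝ}
    {q M : ℕ → ℝ} {B : ℝ} (hq : ∀ n, 2 * N + 2 ≤ q n) (hM0 : ∀ n, 0 ≤ M n) (hMB : ∀ n, M n ≤ B)
    (h0 : ∀ n x, x ∉ Ω → V n x = 0)
    (hV : ∀ n x y, ∀ c : ℝ, 0 < c → |V n x - V n y| ≤ (‖x - y‖ + 4 * c) *
      c ^ (-(N / q n) : ℝ) * unitVol N ^ (-(1 / q n)) * M n) :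
    Equicontinuous V ∧ ∃ C, ∀ n x, |V n x| ≤ C := by
  have hB0 : 0 ≤ B := (hM0 0).trans (hMB 0)
  have hω := unitVol_pos (N := N)
  have hNR : (0 : ℝ) ≤ N := Nat.cast_nonneg N
  set W := max 1 (unitVol N)⁻¹ with hW
  have hW0 : 0 ≤ W := zero_le_one.trans (le_max_left _ _)
  have hq0 : ∀ n, 0 < q n := fun n => by linarith [hq n]
  have hWn : ∀ n, unitVol N ^ (-(1 / q n)) ≤ W := fun n => by
    refine rpow_neg_le_max hω (one_div_nonneg.2 (hq0 n).le) ?_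
    rw [div_le_one (hq0 n)]
    linarith [hq n]
  have hhalf : ∀ n, N / q n ≤ 1 / 2 := fun n => by
    rw [div_le_div_iff₀ (hq0 n) two_pos]; linarith [hq n]
  constructor
  · refine UniformEquicontinuous.equicontinuous ?_
    have hlim : Tendsto (fun d : ℝ => 5 * W * B * d ^ (1 / 2 : ℝ)) (𝓝 0) (𝓝 0) := by
      have := ((Real.continuous_rpow_const (q := 1 / 2) (by norm_num)).tendsto 0).const_mul
        (5 * W * B)
      simpa using this
    rw [Metric.uniformEquicontinuous_iff]
    intro ε hε
    obtain ⟨δ, hδ, hδε⟩ := Metric.eventually_nhds_iff.1 (hlim.eventually (gt_mem_nhds hε))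
    refine ⟨min δ 1, by positivity, fun x y hxy n => ?_⟩
    rcases eq_or_ne x y with rfl | hne
    · rw [dist_self]; exact hε
    have hd0 : 0 < ‖x - y‖ := norm_sub_pos_iff.2 hne
    rw [dist_eq_norm] at hxy
    have hd1 : ‖x - y‖ ≤ 1 := hxy.le.trans (min_le_right _ _)
    refine lt_of_le_of_lt ?_ (hδε (y := ‖x - y‖) (by
      rw [Real.dist_eq, sub_zero, abs_of_pos hd0]; exact hxy.trans_le (min_le_left _ _)))
    -- Morrey's inequality is used with radius `c = ‖x - y‖`, which gives `5 * ‖x - y‖ ^ (1 - N / q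
    -- n)`. Exponents at least `1 / 2` and distances at most `1` yield one Hölder modulus for all
    -- `n`.
    have e1 : ‖x - y‖ * ‖x - y‖ ^ (-(N / q n) : ℝ) ≤ ‖x - y‖ ^ (1 / 2 : ℝ) := by
      have e2 : ‖x - y‖ * ‖x - y‖ ^ (-(N / q n) : ℝ) = ‖x - y‖ ^ (1 - N / q n : ℝ) := by
        rw [sub_eq_add_neg (1 : ℝ), Real.rpow_add hd0, Real.rpow_one]
      rw [e2]
      exact Real.rpow_le_rpow_of_exponent_ge hd0 hd1 (by linarith [hhalf n])
    rw [Real.dist_eq]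
    calc _ ≤ _ := hV n x y _ hd0
      _ = 5 * (‖x - y‖ * ‖x - y‖ ^ (-(N / q n) : ℝ)) * unitVol N ^ (-(1 / q n)) * M n := by ring
      _ ≤ 5 * ‖x - y‖ ^ (1 / 2 : ℝ) * W * B := by
          gcongr
          · exact hM0 n
          · exact hWn n
          · exact hMB n
      _ = _ := by ring
  · obtain ⟨D, hD0, w, hw, hD⟩ := exists_notMem_of_isBounded hN hb
    refine ⟨(D + 4) * W * B, fun n x => ?_⟩
    by_cases hx : x ∈ Ω
    · have := hV n x w 1 one_pos
      rw [h0 n w hw, sub_zero, Real.one_rpow, mul_one, mul_one] at this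
      refine this.trans ?_
      gcongr
      · exact hM0 n
      · exact hD x hx
      · exact hWn n
      · exact hMB n
    · rw [h0 n x hx, abs_zero]; positivity

/-- Lower semicontinuity of the nonlocal energy as `q → ∞`. -/
theorem seminormJ_le_of_tendstoUniformly (hJ : IsKernel J) (hb : Bornology.IsBounded Ω)
    {v : ℕ → Sp N → ℝ} {u : Sp N → ℝ} (hv : ∀ n, Continuous (v n))
    (h0 : ∀ n x, x ∉ Ω → v n x = 0) (hu : Continuous u) (hlim : TendstoUniformly v u atTop)
    {q M : ℕ → ℝ} {ℓ : ℝ} (hq : Tendsto q atTop atTop) (hM0 : ∀ n, 0 ≤ M n)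
    (hM : Tendsto M atTop (𝓝 ℓ)) (hE : ∀ n, ∫ z, nonlocalDensity J (q n) (v n) z ≤ M n ^ q n) :
    seminormJ J u ≤ ℓ := by
  have hℓ : 0 ≤ ℓ := ge_of_tendsto' hM hM0
  have key : ∀ x y, J (x - y) ≠ 0 → |u x - u y| ≤ ℓ := by
    intro x y hxy
    by_contra! hcon
    -- Two intermediate levels: `s'` is exceeded by `u` on a neighbourhood of `(x, y)`, and the gap
    -- `s' - s` absorbs the uniform error at the two points, so that `v n` exceeds `s` there. The
    -- energy is then at least a constant times `s ^ q n`, contradicting `ℓ < s`.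
    obtain ⟨s', hs', hs'u⟩ := exists_between hcon
    obtain ⟨s, hs, hss'⟩ := exists_between hs'
    have hs0 : 0 < s := hℓ.trans_lt hs
    have hj : 0 < J (x - y) := lt_of_le_of_ne (hJ.nonneg _) hxy.symm
    set U : Set (Sp N × Sp N) := {z | J (x - y) / 2 < J (z.1 - z.2)} ∩ {z | s' < |u z.1 - u z.2|} ∩
      Metric.ball (x, y) 1 with hU
    have hJc := hJ.continuous
    have hUo : IsOpen U := ((isOpen_lt (by fun_prop) (by fun_prop)).inter
      (isOpen_lt (by fun_prop) (by fun_prop))).inter Metric.isOpen_ball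
    have hUn : U.Nonempty := ⟨(x, y), ⟨half_lt_self hj, hs'u⟩, Metric.mem_ball_self one_pos⟩
    have hUfin : volume U ≠ ⊤ :=
      ((measure_mono Set.inter_subset_right).trans_lt measure_ball_lt_top).ne
    have hUpos : 0 < volume.real U := ENNReal.toReal_pos (hUo.measure_pos _ hUn).ne' hUfin
    have hκ : 0 < volume.real U * (J (x - y) / 2) := by positivity
    refine absurd (le_of_mul_rpow_le hκ hs0.le hq hM ?_) (not_le.2 hs)
    filter_upwards [Metric.tendstoUniformly_iff.1 hlim ((s' - s) / 2) (by linarith),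
      hq.eventually_gt_atTop 0] with n hn hq0
    refine ⟨hM0 n, le_trans ?_ (hE n)⟩
    have hint := integrable_nonlocalDensity hJ hb hq0 (hv n) (h0 n)
    calc _ = ∫ z in U, J (x - y) / 2 * s ^ q n := by
          rw [setIntegral_const, smul_eq_mul]; ring
      _ ≤ ∫ z in U, nonlocalDensity J (q n) (v n) z := by
          refine setIntegral_mono_on (integrableOn_const hUfin) hint.integrableOn
            hUo.measurableSet fun z hz => ?_
          refine mul_le_mul hz.1.1.le (Real.rpow_le_rpow hs0.le ?_ hq0.le)
            (Real.rpow_nonneg hs0.le _) (hJ.nonneg _)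
          have a1 := hn z.1
          have a2 := hn z.2
          rw [Real.dist_eq] at a1 a2
          have a3 : s' < |u z.1 - u z.2| := hz.1.2
          have a4 : |u z.1 - u z.2| ≤ |u z.1 - v n z.1| + |v n z.1 - v n z.2| +
              |u z.2 - v n z.2| := by
            rw [abs_sub_comm (u z.2)]
            refine le_trans (le_of_eq ?_) (abs_add_three _ _ _)
            congr 1; ring
          linarith
      _ ≤ _ := setIntegral_le_integral hint
          (Eventually.of_forall (nonlocalDensity_nonneg hJ _ _))
  refine Real.sSup_le ?_ hℓ
  rintro t ⟨x, y, hxy, rfl⟩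
  -- The bound is known where `J ≠ 0`; continuity of `u` carries it to the closure.
  have hcl : IsClosed {h : Sp N | |u (y + h) - u y| ≤ ℓ} :=
    isClosed_le (by fun_prop) (by fun_prop)
  have hsub : tsupport J ⊆ {h : Sp N | |u (y + h) - u y| ≤ ℓ} :=
    closure_minimal (fun h hh => key (y + h) y (by simpa using hh)) hcl
  simpa using hsub hxy

/-- If `|u| ≤ T` almost everywhere, then eventually `|v n| ≤ T + δ`, and the normalization gives `1
≤ volume.real Ω * (T + δ) ^ q n`; taking roots gives `1 ≤ T + δ`. -/
theorem one_le_lpNorm_top {v : ℕ → Sp N → ℝ} {u : Sp N → ℝ} (hb : Bornology.IsBounded Ω)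
    (hv : ∀ n, Continuous (v n)) (h0 : ∀ n x, x ∉ Ω → v n x = 0)
    (hu : MemLp u ∞ (volume.restrict Ω))
    (hlim : TendstoUniformly v u atTop) {q : ℕ → ℝ} (hq : Tendsto q atTop atTop)
    (h1 : ∀ n, ∫ x in Ω, |v n x| ^ q n = 1) : 1 ≤ lpNorm u ∞ (volume.restrict Ω) := by
  set T := lpNorm u ∞ (volume.restrict Ω) with hT
  have hT0 : 0 ≤ T := lpNorm_nonneg
  refine le_of_forall_pos_le_add fun δ hδ => ?_
  have hκ : 0 < (volume.real Ω + 1)⁻¹ := by positivity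
  refine le_of_mul_rpow_le hκ zero_le_one hq (tendsto_const_nhds (x := T + δ)) ?_
  filter_upwards [Metric.tendstoUniformly_iff.1 hlim δ hδ, hq.eventually_gt_atTop 0] with n hn hq0
  refine ⟨by positivity, ?_⟩
  rw [Real.one_rpow, mul_one, inv_le_iff_one_le_mul₀' (by positivity)]
  refine (h1 n).ge.trans ?_
  have hint : Integrable fun x => |v n x| ^ q n := by
    refine Continuous.integrable_of_hasCompactSupport
      ((hv n).abs.rpow_const fun _ => Or.inr hq0.le) ?_
    refine hasCompactSupport_of_eq_zero hb fun x hx => ?_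
    rw [h0 n x hx, abs_zero, Real.zero_rpow hq0.ne']
  calc _ ≤ ∫ x in Ω, (T + δ) ^ q n := by
        refine integral_mono_ae hint.integrableOn (integrableOn_const hb.measure_lt_top.ne) ?_
        filter_upwards [ae_le_lpNorm_exponent_top hu] with x hx
        refine Real.rpow_le_rpow (abs_nonneg _) ?_ hq0.le
        have a1 := hn x
        rw [Real.dist_eq, abs_sub_comm] at a1
        have a2 := abs_sub_abs_le_abs_sub (v n x) (u x)
        have a3 : |u x| ≤ T := hx
        linarith
    _ = volume.real Ω * (T + δ) ^ q n := by rw [setIntegral_const, smul_eq_mul]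
    _ ≤ _ := mul_le_mul_of_nonneg_right (by linarith) (by positivity)

/-- A continuous representative of a normalized Sobolev function: Morrey's inequality and the
bound on the nonlocal energy in terms of the Rayleigh quotient. -/
theorem MemW10.exists_normalized (hN : 1 ≤ N) (hJ : IsKernel J) (hΩ : IsOpen Ω)
    (hb : Bornology.IsBounded Ω) {p M I : ℝ} {w : Sp N → ℝ} (hp : 2 * N + 2 ≤ p)
    (hw : MemW10 p Ω w) (hI : ∫ x in Ω, |w x| ^ p = I) (hI0 : 0 < I) (hM : 0 ≤ M)
    (hE : energy J Ω p w w ≤ M ^ p * I) :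
    ∃ V : Sp N → ℝ, Continuous V ∧ (∀ x, x ∉ Ω → V x = 0) ∧
      V =ᵐ[volume] (fun x => I ^ (-(1 / p)) * w x) ∧
      (∀ x y, ∀ c : ℝ, 0 < c → |V x - V y| ≤ (‖x - y‖ + 4 * c) *
        c ^ (-(N / p) : ℝ) * unitVol N ^ (-(1 / p)) * M) ∧
      ∫ x in Ω, |V x| ^ p = 1 ∧ ∫ z, nonlocalDensity J p V z ≤ M ^ p := by
  have hN1 : (1 : ℝ) ≤ N := by exact_mod_cast hN
  have hp2 : 2 < p := by linarith
  have hp0 : 0 < p := by linarith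
  have hω := unitVol_pos (N := N)
  obtain ⟨v, hvc, hv0, hvw, hvm⟩ := hw.exists_continuous hN hΩ hb (by linarith) (by linarith)
  -- The factor normalizing the `L^p` norm. The Morrey bound and the nonlocal term are rescaled
  -- directly, so no weak gradient of the rescaled function is needed.
  set a := I ^ (-(1 / p)) with ha
  have ha0 : 0 < a := Real.rpow_pos_of_pos hI0 _
  have hap : a ^ p = I⁻¹ := by
    rw [ha, ← Real.rpow_mul hI0.le, neg_mul, one_div_mul_cancel hp0.ne', Real.rpow_neg_one]
  have haI : a * I ^ (1 / p) = 1 := by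
    rw [ha, ← Real.rpow_add hI0, neg_add_cancel, Real.rpow_zero]
  have hE' : energy J Ω p w w ≤ (M * I ^ (1 / p)) ^ p := by
    rwa [Real.mul_rpow hM (Real.rpow_nonneg hI0.le _), ← Real.rpow_mul hI0.le,
      one_div_mul_cancel hp0.ne', Real.rpow_one]
  refine ⟨fun x => a * v x, hvc.const_mul a, fun x hx => by simp [hv0 x hx], ?_, ?_, ?_, ?_⟩
  · filter_upwards [hvw] with x hx
    rw [hx]
  · intro x y c hc
    rw [← mul_sub, abs_mul, abs_of_pos ha0]
    have h1 := lpNorm_weakGrad_le hJ hb hp2 (mul_nonneg hM (Real.rpow_nonneg hI0.le _)) hw hvc hv0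
      hvw hE'
    calc _ ≤ a * ((‖x - y‖ + 4 * c) * c ^ (-(N / p) : ℝ) * unitVol N ^ (-(1 / p)) *
          (M * I ^ (1 / p))) := by
          refine mul_le_mul_of_nonneg_left ((hvm x y c hc).trans ?_) ha0.le
          exact mul_le_mul_of_nonneg_left h1 (by positivity)
      _ = (‖x - y‖ + 4 * c) * c ^ (-(N / p) : ℝ) * unitVol N ^ (-(1 / p)) * M *
          (a * I ^ (1 / p)) := by ring
      _ = _ := by rw [haI, mul_one]
  · have h1 : ∀ x, |a * v x| ^ p = I⁻¹ * |v x| ^ p := fun x => by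
      rw [abs_mul, abs_of_pos ha0, Real.mul_rpow ha0.le (abs_nonneg _), hap]
    simp_rw [h1]
    rw [integral_const_mul, inv_mul_eq_one₀ hI0.ne', ← hI]
    refine integral_congr_ae (ae_restrict_of_ae ?_)
    filter_upwards [hvw] with x hx
    rw [hx]
  · have h1 : ∀ z, nonlocalDensity J p (fun x => a * v x) z = I⁻¹ * nonlocalDensity J p v z :=
      fun z => by
        simp only [nonlocalDensity]
        rw [← mul_sub, abs_mul, abs_of_pos ha0, Real.mul_rpow ha0.le (abs_nonneg _), hap]
        ring
    simp_rw [h1]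
    rw [integral_const_mul, inv_mul_le_iff₀ hI0, mul_comm I]
    exact (nonlocal_le_energy hJ hb hp2 hvc hv0 hvw).trans hE

/-- Compactness: normalized functions with bounded energy converge, along a subsequence of
exponents `q n → ∞`, to a competitor for the limit problem. -/
theorem exists_limit_of_energy_le (hN : 1 ≤ N) (hJ : IsKernel J) (hΩ : IsOpen Ω)
    (hb : Bornology.IsBounded Ω) {q M : ℕ → ℝ} {V : ℕ → Sp N → ℝ} {ℓ : ℝ}
    (hq : Tendsto q atTop atTop) (hq2 : ∀ n, 2 * N + 2 ≤ q n) (hM0 : ∀ n, 0 ≤ M n)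
    (hM : Tendsto M atTop (𝓝 ℓ)) (hVc : ∀ n, Continuous (V n)) (hV0 : ∀ n x, x ∉ Ω → V n x = 0)
    (hVm : ∀ n x y, ∀ c : ℝ, 0 < c → |V n x - V n y| ≤ (‖x - y‖ + 4 * c) *
      c ^ (-(N / q n) : ℝ) * unitVol N ^ (-(1 / q n)) * M n)
    (hV1 : ∀ n, ∫ x in Ω, |V n x| ^ q n = 1)
    (hE : ∀ n, ∫ z, nonlocalDensity J (q n) (V n) z ≤ M n ^ q n) :
    ∃ σ : ℕ → ℕ, StrictMono σ ∧ ∃ u : Sp N → ℝ, MemW1Inf0 Ω u ∧ u ≠ 0 ∧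
      TendstoUniformly (fun n => V (σ n)) u atTop ∧ quotientInf J Ω u ≤ ℓ := by
  have hω := unitVol_pos (N := N)
  have hℓ : 0 ≤ ℓ := ge_of_tendsto' hM hM0
  obtain ⟨B, hB⟩ := hM.bddAbove_range
  obtain ⟨heq, C, hC⟩ := equicontinuous_of_morrey hN hb hq2 hM0 (fun n => hB ⟨n, rfl⟩) hV0 hVm
  obtain ⟨σ, hσ, u, huc, hu0, hunif⟩ := exists_subseq_tendstoUniformly hb hV0 hC heq
  have hqσ : Tendsto (fun n => q (σ n)) atTop atTop := hq.comp hσ.tendsto_atTop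
  have hMσ : Tendsto (fun n => M (σ n)) atTop (𝓝 ℓ) := hM.comp hσ.tendsto_atTop
  -- With `c` fixed, `n → ∞` sends the powers of `c` and of the unit volume to `1`; then `c → 0`
  -- removes the term `4 * c`.
  have hlip : ∀ x y, |u x - u y| ≤ ℓ * ‖x - y‖ := by
    intro x y
    have h1 : ∀ c : ℝ, 0 < c → |u x - u y| ≤ (‖x - y‖ + 4 * c) * ℓ := by
      intro c hc
      have a1 : Tendsto (fun n => c ^ (-(N / q (σ n)) : ℝ)) atTop (𝓝 1) := by
        simpa only [neg_div] using tendsto_rpow_div_atTop (b := -N) hc hqσ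
      have a2 : Tendsto (fun n => unitVol N ^ (-(1 / q (σ n)) : ℝ)) atTop (𝓝 1) := by
        simpa only [neg_div] using tendsto_rpow_div_atTop (b := -1) hω hqσ
      have a3 := ((a1.const_mul (‖x - y‖ + 4 * c)).mul a2).mul hMσ
      rw [mul_one, mul_one] at a3
      exact le_of_tendsto_of_tendsto' ((hunif.tendsto_at x).sub (hunif.tendsto_at y)).abs a3
        fun n => hVm (σ n) x y c hc
    have h2 : Tendsto (fun c : ℝ => (‖x - y‖ + 4 * c) * ℓ) (𝓝[>] 0)
        (𝓝 ((‖x - y‖ + 4 * 0) * ℓ)) :=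
      (Continuous.tendsto (by fun_prop) 0).mono_left nhdsWithin_le_nhds
    rw [mul_zero, add_zero, mul_comm] at h2
    exact ge_of_tendsto h2 (eventually_mem_nhdsWithin.mono fun c hc => h1 c hc)
  have hlip' : LipschitzWith ℓ.toNNReal u := LipschitzWith.of_dist_le_mul fun x y => by
    rw [Real.coe_toNNReal _ hℓ, Real.dist_eq, dist_eq_norm]
    exact hlip x y
  have hmem : MemW1Inf0 Ω u := memW1Inf0_of_lipschitz hΩ hb hlip' hu0
  have hT : 1 ≤ lpNorm u ∞ (volume.restrict Ω) := by
    refine one_le_lpNorm_top hb (fun n => hVc (σ n)) (fun n => hV0 (σ n)) hmem.memLp hunif hqσ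
      fun n => hV1 (σ n)
  refine ⟨σ, hσ, u, hmem, ?_, hunif, ?_⟩
  · rintro rfl
    rw [lpNorm_zero] at hT
    linarith
  · have hgrad : lpNorm (weakGrad Ω u) ∞ (volume.restrict Ω) ≤ ℓ := by
      simpa [hℓ] using lpNorm_weakGrad_top_le hΩ hlip'
    have hsemi : seminormJ J u ≤ ℓ :=
      seminormJ_le_of_tendstoUniformly hJ hb (fun n => hVc (σ n)) (fun n => hV0 (σ n)) huc hunif hqσ
        (fun n => hM0 (σ n)) hMσ fun n => hE (σ n)
    rw [quotientInf, div_le_iff₀ (by linarith)]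
    exact (max_le hgrad hsemi).trans (le_mul_of_one_le_right hℓ hT)

end Compactness

/-! ### Upper bound for the first eigenvalue -/

section UpperBound

variable {N : ℕ} {Ω : Set (Sp N)} {J : Sp N → ℝ} {u φ : Sp N → ℝ}

/-- The soft threshold function, vanishing on `[-ε, ε]`. -/
noncomputable def softThreshold (ε s : ℝ) : ℝ := s - max (-ε) (min ε s)

/-- The subtracted clamp is nondecreasing with slope at most `1`, hence so is the difference. -/
theorem abs_softThreshold_sub_le (ε s t : ℝ) :
    |softThreshold ε s - softThreshold ε t| ≤ |s - t| := by
  unfold softThreshold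
  wlog h : t ≤ s generalizing s t
  · rw [abs_sub_comm, abs_sub_comm s]
    exact this t s (le_of_not_ge h)
  rw [abs_of_nonneg (sub_nonneg.2 h), abs_le]
  constructor <;>
  rcases max_cases (-ε) (min ε s) with h1 | h1 <;> rcases max_cases (-ε) (min ε t) with h2 | h2 <;>
  rcases min_cases ε s with h3 | h3 <;> rcases min_cases ε t with h4 | h4 <;> linarith

theorem softThreshold_eq_zero {ε s : ℝ} (h : |s| ≤ ε) : softThreshold ε s = 0 := by
  rw [abs_le] at h
  rw [softThreshold, min_eq_right h.2, max_eq_right h.1, sub_self]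

theorem sub_le_abs_softThreshold {ε : ℝ} (hε : 0 ≤ ε) (s : ℝ) : |s| - ε ≤ |softThreshold ε s| := by
  have h1 : |max (-ε) (min ε s)| ≤ ε :=
    abs_le.2 ⟨le_max_left _ _, max_le (by linarith) (min_le_left _ _)⟩
  have h2 := abs_sub_abs_le_abs_sub s (max (-ε) (min ε s))
  rw [softThreshold]
  linarith

open scoped Convolution

/-- Mollification averages translates against a probability density, and `x - t`, `y - t` have the
same difference as `x`, `y`. It therefore preserves Lipschitz and oscillation bounds with the same
constants. -/
theorem abs_convolution_sub_le (ψ : ContDiffBump (0 : Sp N)) {w : Sp N → ℝ} (hw : Continuous w)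
    {x y : Sp N} {c : ℝ} (h : ∀ t, |w (x - t) - w (y - t)| ≤ c) :
    |(ψ.normed volume ⋆[ContinuousLinearMap.lsmul ℝ ℝ, volume] w) x -
      (ψ.normed volume ⋆[ContinuousLinearMap.lsmul ℝ ℝ, volume] w) y| ≤ c := by
  have hρ : Continuous (ψ.normed volume) := ψ.continuous_normed
  have hi : ∀ x, Integrable fun t => ψ.normed volume t * w (x - t) := fun x =>
    Continuous.integrable_of_hasCompactSupport (by fun_prop) ψ.hasCompactSupport_normed.mul_right
  simp only [convolution_def, ContinuousLinearMap.lsmul_apply, smul_eq_mul]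
  rw [← integral_sub (hi x) (hi y), ← Real.norm_eq_abs]
  refine (norm_integral_le_of_norm_le (g := fun t => ψ.normed volume t * c)
    (ψ.integrable_normed.mul_const c) (Eventually.of_forall fun t => ?_)).trans_eq ?_
  · rw [← mul_sub, norm_mul, Real.norm_of_nonneg (ψ.nonneg_normed _)]
    exact mul_le_mul_of_nonneg_left (h t) (ψ.nonneg_normed _)
  · rw [integral_mul_const, ψ.integral_normed, one_mul]

/-- Truncation and mollification of competitors for the limit problem. -/
theorem exists_isTestFun_approx (hb : Bornology.IsBounded Ω) (hΩ : IsOpen Ω)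
    {L : ℝ≥0} (hu : LipschitzWith L u) (h0 : ∀ x, x ∉ Ω → u x = 0) {D : Set (Sp N)} {S : ℝ}
    (hS : ∀ x y, x - y ∈ D → |u x - u y| ≤ S) {x₀ : Sp N} {T : ℝ} (hT : T < |u x₀|) :
    ∃ φ, IsTestFun Ω φ ∧ LipschitzWith L φ ∧ (∀ x y, x - y ∈ D → |φ x - φ y| ≤ S) ∧
      T < |φ x₀| := by
  -- Thresholding and mollification each cost at most `ε` at `x₀`; the remaining third keeps the
  -- inequality strict.
  set ε := (|u x₀| - T) / 3 with hε
  have hε0 : 0 < ε := by rw [hε]; linarith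
  set w : Sp N → ℝ := fun x => softThreshold ε (u x) with hw
  have hwu : ∀ x y, |w x - w y| ≤ |u x - u y| := fun x y => abs_softThreshold_sub_le _ _ _
  have hwL : LipschitzWith L w := LipschitzWith.of_dist_le_mul fun x y =>
    (hwu x y).trans (hu.dist_le_mul x y)
  -- Thresholding confines the function to a compact subset of `Ω`, leaving room to mollify inside
  -- `Ω`.
  set K : Set (Sp N) := {x | ε ≤ |u x|} with hK
  have hKΩ : K ⊆ Ω := fun x hx => by
    by_contra h
    have : ε ≤ |u x| := hx
    rw [h0 x h, abs_zero] at this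
    linarith
  have hKc : IsCompact K := Metric.isCompact_of_isClosed_isBounded
    (isClosed_le continuous_const hu.continuous.abs) (hb.subset hKΩ)
  have hwK : ∀ x, x ∉ K → w x = 0 := fun x hx => softThreshold_eq_zero (not_le.1 hx).le
  obtain ⟨δ, hδ0, hδ⟩ := hKc.exists_cthickening_subset_open hΩ hKΩ
  -- The first bound keeps the support in `Ω`, the second keeps the change at `x₀` below `ε`; the `+
  -- 1` covers `L = 0`.
  set r := min δ (ε / (L + 1)) with hr
  have hr0 : 0 < r := lt_min hδ0 (by positivity)
  have hLr : L * r ≤ ε := by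
    have h1 : r * (L + 1) ≤ ε := (le_div_iff₀ (by positivity)).1 (min_le_right _ _)
    nlinarith
  set ψ : ContDiffBump (0 : Sp N) := ⟨r / 2, r, half_pos hr0, half_lt_self hr0⟩ with hψ
  have hsupp : tsupport (ψ.normed volume ⋆[ContinuousLinearMap.lsmul ℝ ℝ, volume] w) ⊆
      Metric.cthickening δ K := by
    refine closure_minimal (fun x hx => ?_) Metric.isClosed_cthickening
    by_contra hcon
    refine hx ?_
    rw [convolution_def]
    refine integral_eq_zero_of_ae (Eventually.of_forall fun t => ?_)
    by_cases ht : t ∈ Function.support (ψ.normed volume)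
    · rw [ψ.support_normed_eq, mem_ball_zero_iff] at ht
      have : w (x - t) = 0 := by
        refine hwK _ fun hmem => hcon ?_
        refine Metric.mem_cthickening_of_dist_le x (x - t) δ K hmem ?_
        rw [dist_eq_norm, sub_sub_cancel]
        exact ht.le.trans (min_le_left _ _)
      simp [this]
    · simp [Function.notMem_support.1 ht]
  refine ⟨ψ.normed volume ⋆[ContinuousLinearMap.lsmul ℝ ℝ, volume] w, ⟨?_, ?_, hsupp.trans hδ⟩,
    ?_, ?_, ?_⟩
  · exact ψ.hasCompactSupport_normed.contDiff_convolution_left _ ψ.contDiff_normed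
      hwL.continuous.locallyIntegrable
  · exact hKc.cthickening.of_isClosed_subset (isClosed_tsupport _) hsupp
  · refine LipschitzWith.of_dist_le_mul fun x y => abs_convolution_sub_le ψ hwL.continuous
      fun t => ?_
    have := hwL.dist_le_mul (x - t) (y - t)
    rwa [dist_sub_right] at this
  · intro x y hxy
    refine abs_convolution_sub_le ψ hwL.continuous fun t => (hwu _ _).trans (hS _ _ ?_)
    rwa [sub_sub_sub_cancel_right]
  · have h1 : dist ((ψ.normed volume ⋆[ContinuousLinearMap.lsmul ℝ ℝ, volume] w) x₀) (w x₀) ≤ ε := by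
      refine ContDiffBump.dist_normed_convolution_le hwL.continuous.aestronglyMeasurable
        fun x hx => ?_
      refine (hwL.dist_le_mul x x₀).trans (le_trans ?_ hLr)
      exact mul_le_mul_of_nonneg_left (Metric.mem_ball.1 hx).le L.2
    rw [Real.dist_eq, abs_sub_comm] at h1
    have h2 := sub_le_abs_softThreshold hε0.le (u x₀)
    have h3 := abs_sub_abs_le_abs_sub (w x₀)
      ((ψ.normed volume ⋆[ContinuousLinearMap.lsmul ℝ ℝ, volume] w) x₀)
    have h4 : |u x₀| - ε ≤ |w x₀| := h2
    linarith

/-- The first eigenvalue tested with a fixed smooth function, as `p → ∞`. -/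
theorem IsTestFun.eventually_lambdaOne_lt (hJ : IsKernel J) (hΩ : IsOpen Ω)
    (hb : Bornology.IsBounded Ω) (hφ : IsTestFun Ω φ) {L : ℝ≥0} (hL : LipschitzWith L φ) {X T c : ℝ}
    (hLX : L ≤ X) (hS : ∀ x y, x - y ∈ tsupport J → |φ x - φ y| ≤ X) {x₀ : Sp N}
    (hx₀ : T < |φ x₀|) (hT : 0 < T) (hc : X / T < c) :
    ∀ᶠ p in atTop, lambdaOne J Ω p ^ (1 / p) < c := by
  obtain ⟨A, hA0, hA⟩ := exists_nonlocal_le hJ hb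
  have hX0 : 0 ≤ X := L.2.trans hLX
  have hφc : Continuous φ := hφ.contDiff.continuous
  set U := {x | T < |φ x|} with hU
  have hUo : IsOpen U := isOpen_lt continuous_const hφc.abs
  have hUΩ : U ⊆ Ω := fun x hx => by
    by_contra h
    have : T < |φ x| := hx
    rw [hφ.eq_zero h, abs_zero] at this
    linarith
  have hUfin : volume U ≠ ⊤ := (hb.subset hUΩ).measure_lt_top.ne
  set m := volume.real U with hm
  have hm0 : 0 < m := ENNReal.toReal_pos (hUo.measure_pos _ ⟨x₀, hx₀⟩).ne' hUfin
  -- Ratio of the constant in the energy bound to the measure of the superlevel set; the `+ 1` makes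
  -- its positivity evident.
  set κ := (volume.real Ω + A + 1) / m with hκ
  have hκ0 : 0 < κ := by positivity
  have hlim : Tendsto (fun p : ℝ => κ ^ (1 / p) * (X / T)) atTop (𝓝 (1 * (X / T))) :=
    (tendsto_rpow_div_atTop hκ0 tendsto_id).mul_const _
  rw [one_mul] at hlim
  filter_upwards [hlim.eventually (gt_mem_nhds hc), eventually_gt_atTop 2] with p hp hp2
  refine lt_of_le_of_lt ?_ hp
  have hp0 : 0 < p := by linarith
  have hE : energy J Ω p φ φ ≤ (volume.real Ω + A + 1) * X ^ p := by
    have h1 : ∫ x in Ω, ‖weakGrad Ω φ x‖ ^ p ≤ volume.real Ω * X ^ p := by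
      rw [← smul_eq_mul, ← setIntegral_const]
      refine integral_mono_of_nonneg (Eventually.of_forall fun _ =>
        Real.rpow_nonneg (norm_nonneg _) _) (integrableOn_const hb.measure_lt_top.ne) ?_
      filter_upwards [weakGrad_ae_eq_gradient hΩ hL] with x hx
      rw [hx]
      exact Real.rpow_le_rpow (norm_nonneg _) ((norm_gradient_le hL x).trans hLX) hp0.le
    have h2 := hA p X φ hp0 hX0 hφc (fun x hx => hφ.eq_zero hx) hS
    have h3 : 0 ≤ X ^ p := Real.rpow_nonneg hX0 _
    rw [energy_self_eq hJ hb hp2 hφc (fun x hx => hφ.eq_zero hx) (ae_eq_refl φ)]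
    linarith
  have hI : m * T ^ p ≤ ∫ x in Ω, |φ x| ^ p := by
    have hint : Integrable fun x => |φ x| ^ p :=
      Continuous.integrable_of_hasCompactSupport (hφc.abs.rpow_const fun _ => Or.inr hp0.le)
        (hasCompactSupport_of_eq_zero hb fun x hx => by
          rw [hφ.eq_zero hx, abs_zero, Real.zero_rpow hp0.ne'])
    rw [← smul_eq_mul, hm, ← setIntegral_const]
    calc _ ≤ ∫ x in U, |φ x| ^ p := setIntegral_mono_on (integrableOn_const hUfin)
          hint.integrableOn hUo.measurableSet fun x hx =>
            Real.rpow_le_rpow hT.le (le_of_lt hx) hp0.le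
      _ ≤ _ := setIntegral_mono_set hint.integrableOn
          (Eventually.of_forall fun _ => Real.rpow_nonneg (abs_nonneg _) _)
          (LE.le.eventuallyLE hUΩ)
  have hTp : 0 < T ^ p := Real.rpow_pos_of_pos hT _
  have hne : ¬ φ =ᵐ[volume] 0 := by
    intro h
    have : ∫ x in Ω, |φ x| ^ p = 0 := by
      refine integral_eq_zero_of_ae (ae_restrict_of_ae ?_)
      filter_upwards [h] with x hx
      simp [hx, hp0.ne']
    nlinarith
  have h1 : lambdaOne J Ω p ≤ κ * (X / T) ^ p := by
    refine (lambdaOne_le hJ (hφ.memW10 hΩ hb p) hne).trans ?_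
    rw [Real.div_rpow hX0 hT.le, hκ, div_mul_div_comm]
    have h3 : 0 ≤ X ^ p := Real.rpow_nonneg hX0 _
    exact div_le_div₀ (by positivity) hE (by positivity) hI
  have h2 := Real.rpow_le_rpow (lambdaOne_nonneg hJ p) h1 (one_div_nonneg.2 hp0.le)
  have hXT : 0 ≤ X / T := div_nonneg hX0 hT.le
  rwa [Real.mul_rpow hκ0.le (Real.rpow_nonneg hXT _), ← Real.rpow_mul hXT,
    mul_one_div_cancel hp0.ne', Real.rpow_one] at h2

theorem abs_sub_le_seminormJ (hb : Bornology.IsBounded Ω) (hu : Continuous u)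
    (h0 : ∀ x, x ∉ Ω → u x = 0) {x y : Sp N} (hxy : x - y ∈ tsupport J) :
    |u x - u y| ≤ seminormJ J u := by
  obtain ⟨C, hC⟩ := hu.bounded_above_of_compact_support (hasCompactSupport_of_eq_zero hb h0)
  refine le_csSup ⟨C + C, ?_⟩ ⟨x, y, hxy, rfl⟩
  rintro t ⟨x, y, -, rfl⟩
  exact (abs_sub _ _).trans (add_le_add (hC x) (hC y))

theorem MemW1Inf0.lpNorm_pos (hΩ : IsOpen Ω) (hu : MemW1Inf0 Ω u) (h : u ≠ 0) :
    0 < lpNorm u ∞ (volume.restrict Ω) := by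
  refine lt_of_le_of_ne lpNorm_nonneg fun h' => h ?_
  rw [eq_comm, lpNorm_eq_zero hu.memLp (by simp)] at h'
  have h1 := Measure.eqOn_open_of_ae_eq h' hΩ hu.continuous.continuousOn continuousOn_const
  ext1 x
  by_cases hx : x ∈ Ω
  · exact h1 hx
  · exact hu.eq_zero x hx

/-- The upper bound in terms of a competitor for the limit problem. -/
theorem MemW1Inf0.eventually_lambdaOne_lt (hJ : IsKernel J) (hΩ : IsOpen Ω)
    (hb : Bornology.IsBounded Ω) (hu : MemW1Inf0 Ω u) (h0 : u ≠ 0) {c : ℝ}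
    (hc : quotientInf J Ω u < c) : ∀ᶠ p in atTop, lambdaOne J Ω p ^ (1 / p) < c := by
  have hT0 := hu.lpNorm_pos hΩ h0
  rw [quotientInf] at hc
  set T := lpNorm u ∞ (volume.restrict Ω) with hT
  set X := max (lpNorm (weakGrad Ω u) ∞ (volume.restrict Ω)) (seminormJ J u) with hX
  have hX0 : 0 ≤ X := lpNorm_nonneg.trans (le_max_left _ _)
  have hc0 : 0 < c := (div_nonneg hX0 hT0.le).trans_lt hc
  rw [div_lt_comm₀ hT0 hc0] at hc
  -- A level below the sup norm, hence exceeded at some point, with `X / T'` still below `c`.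
  obtain ⟨T', hT'1, hT'2⟩ := exists_between hc
  have hT'0 : 0 < T' := (div_nonneg hX0 hc0.le).trans_lt hT'1
  obtain ⟨x₀, hx₀⟩ : ∃ x, T' < |u x| := by
    by_contra! h
    refine hT'2.not_ge ?_
    rw [hT, ← toReal_eLpNorm hu.memLp.1]
    refine ENNReal.toReal_le_of_le_ofReal hT'0.le ?_
    rw [eLpNorm_exponent_top]
    exact eLpNormEssSup_le_of_ae_bound (Eventually.of_forall h)
  obtain ⟨φ, hφ, hφL, hφS, hφT⟩ := exists_isTestFun_approx hb hΩ (hu.lipschitzWith hΩ) hu.eq_zero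
    (fun x y hxy => abs_sub_le_seminormJ hb hu.continuous hu.eq_zero hxy) hx₀
  refine hφ.eventually_lambdaOne_lt hJ hΩ hb hφL (X := X) ?_ (fun x y hxy => (hφS x y hxy).trans
    (le_max_right _ _)) hφT hT'0 ?_
  · rw [Real.coe_toNNReal _ lpNorm_nonneg]
    exact le_max_left _ _
  · rwa [div_lt_comm₀ hT'0 hc0]

end UpperBound

/-! ### The limit of the first eigenvalue -/

section Limit

variable {N : ℕ} {Ω : Set (Sp N)} {J : Sp N → ℝ} {u : Sp N → ℝ}

theorem exists_isTestFun_ne_zero (hΩ : IsOpen Ω) (hne : Ω.Nonempty) :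
    ∃ φ, IsTestFun Ω φ ∧ φ ≠ 0 := by
  obtain ⟨x, hx⟩ := hne
  obtain ⟨φ, h1, h2, h3, -, h4⟩ := exists_contDiff_tsupport_subset (n := ⊤) (hΩ.mem_nhds hx)
  exact ⟨φ, ⟨h3, h2, h1⟩, fun h => by simp [h] at h4⟩

theorem IsTestFun.memW1Inf0 {φ : Sp N → ℝ} (hΩ : IsOpen Ω) (hb : Bornology.IsBounded Ω)
    (hφ : IsTestFun Ω φ) : MemW1Inf0 Ω φ := by
  obtain ⟨C, hC⟩ := hφ.exists_lipschitzWith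
  exact memW1Inf0_of_lipschitz hΩ hb hC fun x hx => hφ.eq_zero hx

theorem quotientInf_nonneg (J : Sp N → ℝ) (Ω : Set (Sp N)) (u : Sp N → ℝ) :
    0 ≤ quotientInf J Ω u :=
  div_nonneg (lpNorm_nonneg.trans (le_max_left _ _)) lpNorm_nonneg

theorem LambdaInf_le (hu : MemW1Inf0 Ω u) (h0 : u ≠ 0) : LambdaInf J Ω ≤ quotientInf J Ω u := by
  refine csInf_le ⟨0, ?_⟩ ⟨u, hu, h0, rfl⟩
  rintro t ⟨u, -, -, rfl⟩
  exact quotientInf_nonneg J Ω u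

theorem eventually_lambdaOne_lt (hJ : IsKernel J) (hΩ : IsOpen Ω) (hne : Ω.Nonempty)
    (hb : Bornology.IsBounded Ω) {c : ℝ} (hc : LambdaInf J Ω < c) :
    ∀ᶠ p in atTop, lambdaOne J Ω p ^ (1 / p) < c := by
  obtain ⟨φ, hφ, hφ0⟩ := exists_isTestFun_ne_zero hΩ hne
  rw [LambdaInf] at hc
  obtain ⟨_, ⟨u, hu, hu0, rfl⟩, huc⟩ :=
    exists_lt_of_csInf_lt (by exact ⟨_, φ, hφ.memW1Inf0 hΩ hb, hφ0, rfl⟩) hc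
  exact hu.eventually_lambdaOne_lt hJ hΩ hb hu0 huc

theorem MemW10.integral_rpow_pos {p : ℝ} (hp : 0 < p) (hΩ : IsOpen Ω) (hu : MemW10 p Ω u)
    (h0 : ¬ u =ᵐ[volume] 0) : 0 < ∫ x in Ω, |u x| ^ p := by
  refine lt_of_le_of_ne (integral_nonneg fun _ => Real.rpow_nonneg (abs_nonneg _) _) fun h => h0 ?_
  have hint : Integrable (fun x => |u x| ^ p) (volume.restrict Ω) := by
    have := hu.memLp.integrable_norm_rpow (by simpa using hp) ENNReal.ofReal_ne_top
    rwa [ENNReal.toReal_ofReal hp.le] at this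
  have h1 := (integral_eq_zero_iff_of_nonneg
    (fun _ => Real.rpow_nonneg (abs_nonneg _) _) hint).1 h.symm
  rw [Filter.EventuallyEq, ae_restrict_iff' hΩ.measurableSet] at h1
  filter_upwards [h1] with x hx
  by_cases hxΩ : x ∈ Ω
  · have := hx hxΩ
    rw [Pi.zero_apply, Real.rpow_eq_zero (abs_nonneg _) hp.ne'] at this
    exact abs_eq_zero.1 this
  · exact hu.eq_zero x hxΩ

/-- Otherwise near-minimizers along exponents tending to infinity would converge to a competitor
whose quotient lies below the infimum `LambdaInf J Ω`. -/
theorem eventually_lt_lambdaOne (hN : 1 ≤ N) (hJ : IsKernel J) (hΩ : IsOpen Ω) (hne : Ω.Nonempty)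
    (hb : Bornology.IsBounded Ω) {c : ℝ} (hc : c < LambdaInf J Ω) :
    ∀ᶠ p in atTop, c < lambdaOne J Ω p ^ (1 / p) := by
  by_contra hcon
  rw [Filter.eventually_atTop] at hcon
  push Not at hcon
  choose q hq hqc using fun n : ℕ => hcon (max n (2 * N + 2))
  have hq2 : ∀ n, 2 * (N : ℝ) + 2 ≤ q n := fun n => (le_max_right _ _).trans (hq n)
  have hq0 : ∀ n, 0 < q n := fun n => by linarith [hq2 n, (Nat.cast_nonneg N : (0 : ℝ) ≤ N)]
  have hqt : Tendsto q atTop atTop :=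
    tendsto_atTop_mono (fun n => (le_max_left _ _).trans (hq n)) tendsto_natCast_atTop_atTop
  have hc0 : 0 ≤ c := (Real.rpow_nonneg (lambdaOne_nonneg hJ _) _).trans (hqc 0)
  -- The room between `c` and `c'` lets near-minimizers replace minimizers, whose existence is not
  -- assumed.
  obtain ⟨c', hcc', hc'⟩ := exists_between hc
  have hc'0 : 0 < c' := hc0.trans_lt hcc'
  obtain ⟨φ, hφ, hφ0⟩ := exists_isTestFun_ne_zero hΩ hne
  have hφ0' : ¬ φ =ᵐ[volume] 0 := fun h =>
    hφ0 ((hφ.contDiff.continuous.ae_eq_iff_eq volume continuous_const).1 h)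
  have hex : ∀ n, ∃ w, MemW10 (q n) Ω w ∧ ¬ w =ᵐ[volume] 0 ∧
      energy J Ω (q n) w w / (∫ x in Ω, |w x| ^ q n) < c' ^ q n := by
    intro n
    have h1 : lambdaOne J Ω (q n) < c' ^ q n := by
      have := Real.rpow_lt_rpow (Real.rpow_nonneg (lambdaOne_nonneg hJ _) _)
        ((hqc n).trans_lt hcc') (hq0 n)
      rwa [← Real.rpow_mul (lambdaOne_nonneg hJ _), one_div_mul_cancel (hq0 n).ne',
        Real.rpow_one] at this
    rw [lambdaOne] at h1
    obtain ⟨_, ⟨w, hw, hw0, rfl⟩, hlt⟩ :=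
      exists_lt_of_csInf_lt (by exact ⟨_, φ, hφ.memW10 hΩ hb (q n), hφ0', rfl⟩) h1
    exact ⟨w, hw, hw0, hlt⟩
  choose w hw hw0 hwE using hex
  have hI := fun n => (hw n).integral_rpow_pos (hq0 n) hΩ (hw0 n)
  choose V hVc hV0 hVw hVm hV1 hVE using fun n => (hw n).exists_normalized hN hJ hΩ hb (hq2 n) rfl
    (hI n) hc'0.le ((div_le_iff₀ (hI n)).1 (hwE n).le)
  obtain ⟨σ, -, u, hu, hu0, -, hle⟩ := exists_limit_of_energy_le hN hJ hΩ hb hqt hq2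
    (fun _ => hc'0.le) tendsto_const_nhds hVc hV0 hVm hV1 hVE
  exact (hc'.trans_le (LambdaInf_le hu hu0)).not_ge hle

end Limit

end LocalNonlocal

/-! ### Convergence of eigenvalues and eigenfunctions -/

open LocalNonlocal
theorem theorem1p2 (N : ℕ) (hN : 1 ≤ N) (J : Sp N → ℝ) (hJ : IsKernel J)
    (Ω : Set (Sp N)) (hΩ : IsC1HolderDomain Ω) :
    Tendsto (fun p : ℝ => lambdaOne J Ω p ^ (1 / p)) atTop (𝓝 (LambdaInf J Ω)) ∧
    -- `u p` is, for each `p`, a nonnegative first eigenfunction normalized by `‖u p‖_p = 1`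
    ∀ u : ℝ → Sp N → ℝ,
      (∀ p : ℝ, 2 ≤ p → IsEigenfunction J Ω p (lambdaOne J Ω p) (u p) ∧
        (∀ᵐ x ∂(volume.restrict Ω), 0 ≤ u p x) ∧
        lpNorm (u p) (ENNReal.ofReal p) (volume.restrict Ω) = 1) →
      -- `v n` is the continuous representative of `u (q n)`
      ∃ (q : ℕ → ℝ) (v : ℕ → Sp N → ℝ) (uInf : Sp N → ℝ),
        (∀ n, 2 ≤ q n) ∧ Tendsto q atTop atTop ∧
        (∀ n, Continuous (v n) ∧ (∀ x, x ∉ Ω → v n x = 0) ∧ v n =ᵐ[volume] u (q n)) ∧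
        MemW1Inf0 Ω uInf ∧ uInf ≠ 0 ∧
        TendstoUniformlyOn v uInf atTop (closure Ω) ∧
        LambdaInf J Ω = quotientInf J Ω uInf := by
  have hb := hΩ.isBounded
  have hlim : Tendsto (fun p : ℝ => lambdaOne J Ω p ^ (1 / p)) atTop (𝓝 (LambdaInf J Ω)) :=
    tendsto_order.2 ⟨fun _ hc => eventually_lt_lambdaOne hN hJ hΩ.isOpen hΩ.isConnected.nonempty hb
      hc, fun _ hc => eventually_lambdaOne_lt hJ hΩ.isOpen hΩ.isConnected.nonempty hb hc⟩
  refine ⟨hlim, fun u hu => ?_⟩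
  -- The shift puts every exponent in the range of the Morrey estimates.
  set q : ℕ → ℝ := fun n => n + (2 * N + 2) with hq
  have hq2 : ∀ n, 2 * (N : ℝ) + 2 ≤ q n := fun n => le_add_of_nonneg_left (Nat.cast_nonneg n)
  have hqt : Tendsto q atTop atTop := tendsto_atTop_add_const_right _ _ tendsto_natCast_atTop_atTop
  have hN1 : (1 : ℝ) ≤ N := by exact_mod_cast hN
  have hq' : ∀ n, 2 < q n := fun n => by linarith [hq2 n]
  have hq0 : ∀ n, 0 < q n := fun n => by linarith [hq' n]
  have hI : ∀ n, ∫ x in Ω, |u (q n) x| ^ q n = 1 := by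
    intro n
    obtain ⟨h1, -, h2⟩ := hu (q n) (hq' n).le
    rw [lpNorm_eq_integral_norm_rpow_toReal (by simpa using hq0 n) ENNReal.ofReal_ne_top
      h1.mem.memLp.1, ENNReal.toReal_ofReal (hq0 n).le] at h2
    have h3 := Real.rpow_inv_rpow (x := ∫ x in Ω, ‖u (q n) x‖ ^ q n)
      (integral_nonneg fun _ => Real.rpow_nonneg (norm_nonneg _) _) (hq0 n).ne'
    rw [h2, Real.one_rpow] at h3
    exact h3.symm
  -- The eigenvalue equation tested with the eigenfunction itself: with `M n = lambdaOne J Ω (q n) ^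
  -- (1 / q n)` the energy bound is attained, and `M` tends to `LambdaInf J Ω`.
  have hE : ∀ n, energy J Ω (q n) (u (q n)) (u (q n)) ≤
      (lambdaOne J Ω (q n) ^ (1 / q n)) ^ q n * 1 := by
    intro n
    have h1 := (hu (q n) (hq' n).le).1
    rw [h1.weak_eq _ h1.mem, ← Real.rpow_mul (lambdaOne_nonneg hJ _),
      one_div_mul_cancel (hq0 n).ne', Real.rpow_one, ← hI n]
    refine le_of_eq ?_
    congr 2 with x
    rw [mul_assoc, ← abs_mul_abs_self, rpow_sub_two_mul (abs_nonneg _) (hq' n)]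
  choose V hVc hV0 hVw hVm hV1 hVE using fun n =>
    (hu (q n) (hq' n).le).1.mem.exists_normalized hN hJ hΩ.isOpen hb (hq2 n) (hI n) one_pos
      (Real.rpow_nonneg (lambdaOne_nonneg hJ _) _) (hE n)
  obtain ⟨σ, hσ, uInf, hu1, hu0, hunif, hle⟩ := exists_limit_of_energy_le hN hJ hΩ.isOpen hb hqt hq2
    (fun n => Real.rpow_nonneg (lambdaOne_nonneg hJ _) _) (hlim.comp hqt) hVc hV0 hVm hV1 hVE
  refine ⟨fun n => q (σ n), fun n => V (σ n), uInf, fun n => (hq' _).le, hqt.comp hσ.tendsto_atTop,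
    fun n => ⟨hVc _, hV0 _, ?_⟩, hu1, hu0, hunif.tendstoUniformlyOn,
    le_antisymm (LambdaInf_le hu1 hu0) hle⟩
  simpa using hVw (σ n)
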